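/- Conventions. $\mathrm{L}^\infty(X,\mu)$ is the $*$-algebra of essentially bounded measurable functions $X\to\mathbb{C}$ modulo a.e. equality; a $*$-isomorphism is trace preserving if it preserves integrals. Probability space isomorphisms are taken modulo a.e. equality, and $\operatorname{Aut}(X,\mu)$ is the group of automorphisms of $(X,\mu)$. For an isomorphism $\Delta:(X,\mu)\to(Y,\nu)$ put $\Delta_*:\mathrm{L}^\infty(X)\to \mathrm{L}^\infty(Y)$, $\Delta_*(f)=f\circ\Delta^{-1}$. For an action $\Gamma\curvearrowright I$ of a countable group on a countable set and a standard probability space $(X_0,\mu_0)$ with $\mu_0$ not concentrated on one atom, the generalized Bernoulli action $\Gamma\curvearrowright(X_0,\mu_0)^I$ is $(g\cdot x)_i=x_{g^{-1}\cdot i}$. For $i\in I$ let $\pi_i:\mathrm{L}^\infty(X_0,\mu_0)\to \mathrm{L}^\infty((X_0,\mu_0)^I)$, $\pi_i(f)(x)=f(x_i)$. Given probability measure preserving actions $\Gamma\curvearrowright(X,\mu)$ and $\Lambda\curvearrowright(Y,\nu)$ for which $\Gamma\to\operatorname{Aut}(X,\mu)$ and $\Lambda\to\operatorname{Aut}(Y,\nu)$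 are injective, so that $\Gamma$ and $\Lambda$ are viewed as subgroups, a commensuration of the two actions is an isomorphism $\Delta:(X,\mu)\to(Y,\nu)$ such that $\Gamma\cap\Delta^{-1}\Lambda\Delta$ has finite index in $\Gamma$ and $\Lambda\cap\Delta\Gamma\Delta^{-1}$ has finite index in $\Lambda$. Proposition 5.9. Let $\Gamma\curvearrowright I$ and $\Lambda\curvearrowright J$ be faithful actions of countable groups on countable sets such that, for all $i\in I$ and $j\in J$, the actions $\operatorname{Stab} i\curvearrowright I\setminus\{i\}$ and $\operatorname{Stab} j\curvearrowright J\setminus\{j\}$ have infinite orbits. Let $(X_0,\mu_0)$ and $(Y_0,\nu_0)$ be standard probability spaces, neither of which is concentrated on one atom, and consider the generalized Bernoulli actions $\Gamma\curvearrowright(X,\mu):=(X_0,\mu_0)^I$ and $\Lambda\curvearrowright(Y,\nu):=(Y_0,\nu_0)^J$. 1. Let $\delta:\Gamma_1\to\Lambda_1$ be an isomorphism between finite index subgroups $\Gamma_1<\Gamma$ and $\Lambda_1<\Lambda$, and let $\eta:I\to J$ be a bijection with $\eta(g\cdot i)=\delta(g)\cdot\eta(i)$ for all $g\in\Gamma_1$,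 $i\in I$. For every orbit $\bar i\in\Gamma_1\backslash I$ let $\alpha_{\bar i}:\mathrm{L}^\infty(X_0,\mu_0)\to \mathrm{L}^\infty(Y_0,\nu_0)$ be a trace preserving $*$-isomorphism. Then there is a unique isomorphism $\Delta:(X,\mu)\to(Y,\nu)$ satisfying $$\Delta_*\circ\pi_i=\pi_{\eta(i)}\circ\alpha_{\bar i}\qquad\text{for all } i\in I,$$ and $\Delta$ is a commensuration of $\Gamma\curvearrowright(X_0,\mu_0)^I$ and $\Lambda\curvearrowright(Y_0,\nu_0)^J$. 2. Conversely, every commensuration $\Delta$ of $\Gamma\curvearrowright(X_0,\mu_0)^I$ and $\Lambda\curvearrowright(Y_0,\nu_0)^J$ arises in this way: there exist $\Gamma_1,\Lambda_1,\delta,\eta$ and $(\alpha_{\bar i})_{\bar i\in\Gamma_1\backslash I}$ as in 1 such that $\Delta_*\circ\pi_i=\pi_{\eta(i)}\circ\alpha_{\bar i}$ for all $i\in I$. -/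

import Mathlib

open MeasureTheory Filter
open scoped ENNReal

namespace GenBernoulli

/-! ### The von Neumann algebra `L^∞(X, μ)` -/

section LInfty

variable {X Y : Type*} [MeasurableSpace X] [MeasurableSpace Y]

/-- Classes of measurable complex functions modulo a.e. equality form a commutative ring; addition
and multiplication are Mathlib's (pointwise almost everywhere). -/
noncomputable instance instCommRingAEEqFun (μ : Measure X) : CommRing (X →ₘ[μ] ℂ) where
  __ := (inferInstance : AddCommGroup (X →ₘ[μ] ℂ))
  __ := (inferInstance : CommMonoid (X →ₘ[μ] ℂ))
  left_distrib f g h := by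
    induction f, g, h using AEEqFun.induction_on₃ with
    | _ f hf g hg h hh => simp only [AEEqFun.mk_mul_mk, AEEqFun.mk_add_mk, mul_add]
  right_distrib f g h := by
    induction f, g, h using AEEqFun.induction_on₃ with
    | _ f hf g hg h hh => simp only [AEEqFun.mk_mul_mk, AEEqFun.mk_add_mk, add_mul]
  zero_mul f := by
    refine AEEqFun.ext ?_
    filter_upwards [AEEqFun.coeFn_mul 0 f, AEEqFun.coeFn_zero (α := X) (β := ℂ) (μ := μ)]
      with x h1 h2
    rw [h1, Pi.mul_apply, h2, Pi.zero_apply, zero_mul]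
  mul_zero f := by
    refine AEEqFun.ext ?_
    filter_upwards [AEEqFun.coeFn_mul f 0, AEEqFun.coeFn_zero (α := X) (β := ℂ) (μ := μ)]
      with x h1 h2
    rw [h1, Pi.mul_apply, h2, Pi.zero_apply, mul_zero]

/-- The `ℂ`-algebra structure, with Mathlib's scalar multiplication. -/
noncomputable instance instAlgebraAEEqFun (μ : Measure X) : Algebra ℂ (X →ₘ[μ] ℂ) :=
  Algebra.ofModule
    (fun c f g => by
      induction f, g using AEEqFun.induction_on₂ with
      | _ f hf g hg => simp only [AEEqFun.mk_mul_mk, AEEqFun.smul_mk, smul_mul_assoc])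
    (fun c f g => by
      induction f, g using AEEqFun.induction_on₂ with
      | _ f hf g hg => simp only [AEEqFun.mk_mul_mk, AEEqFun.smul_mk, mul_smul_comm])

/-- The star operation is Mathlib's (pointwise complex conjugation). -/
noncomputable instance instStarRingAEEqFun (μ : Measure X) : StarRing (X →ₘ[μ] ℂ) where
  star_involutive := star_involutive
  star_mul f g := by
    refine AEEqFun.ext ?_
    filter_upwards [AEEqFun.coeFn_star (f * g), AEEqFun.coeFn_mul f g,
      AEEqFun.coeFn_mul (star g) (star f), AEEqFun.coeFn_star f, AEEqFun.coeFn_star g]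
      with x h1 h2 h3 h4 h5
    rw [h1, Pi.star_apply, h2, h3, Pi.mul_apply, Pi.mul_apply, h4, h5, Pi.star_apply,
      Pi.star_apply, star_mul]
  star_add f g := by
    refine AEEqFun.ext ?_
    filter_upwards [AEEqFun.coeFn_star (f + g), AEEqFun.coeFn_add f g,
      AEEqFun.coeFn_add (star f) (star g), AEEqFun.coeFn_star f, AEEqFun.coeFn_star g]
      with x h1 h2 h3 h4 h5
    simp [h1, h2, h3, h4, h5]

instance instStarModuleAEEqFun (μ : Measure X) : StarModule ℂ (X →ₘ[μ] ℂ) where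
  star_smul c f := by
    refine AEEqFun.ext ?_
    filter_upwards [AEEqFun.coeFn_star (c • f), AEEqFun.coeFn_smul c f,
      AEEqFun.coeFn_smul (star c) (star f), AEEqFun.coeFn_star f] with x h1 h2 h3 h4
    rw [h1, Pi.star_apply, h2, h3, Pi.smul_apply, Pi.smul_apply, h4, Pi.star_apply, star_smul]

/-- `L^∞(X, μ)`: the `*`-algebra of essentially bounded measurable functions `X → ℂ`, modulo
equality almost everywhere. -/
noncomputable def LInfty (μ : Measure X) : StarSubalgebra ℂ (X →ₘ[μ] ℂ) where
  carrier := {f | MemLp f ∞ μ}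
  mul_mem' {f g} hf hg := (memLp_congr_ae (AEEqFun.coeFn_mul f g)).2 (MemLp.mul hg hf)
  add_mem' {f g} hf hg := (memLp_congr_ae (AEEqFun.coeFn_add f g)).2 (MemLp.add hf hg)
  algebraMap_mem' c := by
    have h : (algebraMap ℂ (X →ₘ[μ] ℂ)) c = c • (1 : X →ₘ[μ] ℂ) := Algebra.algebraMap_eq_smul_one c
    rw [h]
    refine (memLp_congr_ae (AEEqFun.coeFn_smul c (1 : X →ₘ[μ] ℂ))).2 (MemLp.const_smul ?_ c)
    exact (memLp_congr_ae (AEEqFun.coeFn_one (α := X) (β := ℂ) (μ := μ))).2 (memLp_top_const 1)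
  star_mem' {f} hf := (memLp_congr_ae (AEEqFun.coeFn_star f)).2 (MemLp.star hf)

/-- Composition with a measure preserving map `φ : X → Y`, as a map
`L^∞(Y, ν) → L^∞(X, μ)`, `f ↦ f ∘ φ`. -/
noncomputable def LInfty.comp {μ : Measure X} {ν : Measure Y} (φ : X → Y)
    (hφ : MeasurePreserving φ μ ν) (f : LInfty ν) : LInfty μ :=
  ⟨(f : Y →ₘ[ν] ℂ).compMeasurePreserving φ hφ,
    (memLp_congr_ae (AEEqFun.coeFn_compMeasurePreserving (f : Y →ₘ[ν] ℂ) hφ)).2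
      (MemLp.comp_measurePreserving f.2 hφ)⟩

/-- The trace on `L^∞(X, μ)` is integration against `μ`; a `*`-isomorphism is trace preserving if
it preserves integrals. -/
def IsTracePreserving {μ : Measure X} {ν : Measure Y} (α : LInfty μ ≃⋆ₐ[ℂ] LInfty ν) : Prop :=
  ∀ f : LInfty μ, ∫ y, (α f : Y →ₘ[ν] ℂ) y ∂ν = ∫ x, (f : X →ₘ[μ] ℂ) x ∂μ

end LInfty

/-! ### Probability space isomorphisms modulo equality almost everywhere -/

section ProbIso

variable {X Y Z : Type*} [MeasurableSpace X] [MeasurableSpace Y] [MeasurableSpace Z]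

/-- A representative of an isomorphism of measure spaces `(X, μ) → (Y, ν)`: a measure preserving
map together with a measure preserving map in the other direction, mutually inverse almost
everywhere. -/
structure IsoRep (μ : Measure X) (ν : Measure Y) where
  toFun : X → Y
  invFun : Y → X
  mp_toFun : MeasurePreserving toFun μ ν
  mp_invFun : MeasurePreserving invFun ν μ
  left_inv : ∀ᵐ x ∂μ, invFun (toFun x) = x
  right_inv : ∀ᵐ y ∂ν, toFun (invFun y) = y

namespace IsoRep

variable {μ : Measure X} {ν : Measure Y} {ξ : Measure Z}

/-- Two representatives are identified when they agree almost everywhere. -/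
instance setoid (μ : Measure X) (ν : Measure Y) : Setoid (IsoRep μ ν) where
  r a b := a.toFun =ᵐ[μ] b.toFun
  iseqv := ⟨fun _ => EventuallyEq.rfl, fun h => h.symm, fun h h' => h.trans h'⟩

/-- The identity. -/
def refl (μ : Measure X) : IsoRep μ μ where
  toFun := id
  invFun := id
  mp_toFun := .id μ
  mp_invFun := .id μ
  left_inv := by simp
  right_inv := by simp

/-- The inverse. -/
def symm (a : IsoRep μ ν) : IsoRep ν μ where
  toFun := a.invFun
  invFun := a.toFun
  mp_toFun := a.mp_invFun
  mp_invFun := a.mp_toFun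
  left_inv := a.right_inv
  right_inv := a.left_inv

/-- The composition, first `a` and then `b`. -/
def trans (a : IsoRep μ ν) (b : IsoRep ν ξ) : IsoRep μ ξ where
  toFun := b.toFun ∘ a.toFun
  invFun := a.invFun ∘ b.invFun
  mp_toFun := b.mp_toFun.comp a.mp_toFun
  mp_invFun := a.mp_invFun.comp b.mp_invFun
  left_inv := by
    filter_upwards [a.left_inv, a.mp_toFun.quasiMeasurePreserving.ae b.left_inv] with x h1 h2
    simp [h1, h2]
  right_inv := by
    filter_upwards [b.right_inv, b.mp_invFun.quasiMeasurePreserving.ae a.right_inv] with x h1 h2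
    simp [h1, h2]

theorem symm_congr {a b : IsoRep μ ν} (h : a ≈ b) : a.symm ≈ b.symm := by
  change a.invFun =ᵐ[ν] b.invFun
  have h' : ∀ᵐ x ∂μ, a.toFun x = b.toFun x := h
  filter_upwards [a.mp_invFun.quasiMeasurePreserving.ae h', a.right_inv,
    a.mp_invFun.quasiMeasurePreserving.ae b.left_inv] with y h1 h2 h3
  rw [← h1, h2] at h3
  exact h3.symm

theorem trans_congr {a a' : IsoRep μ ν} {b b' : IsoRep ν ξ} (ha : a ≈ a') (hb : b ≈ b') :
    a.trans b ≈ a'.trans b' := by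
  change b.toFun ∘ a.toFun =ᵐ[μ] b'.toFun ∘ a'.toFun
  have ha' : ∀ᵐ x ∂μ, a.toFun x = a'.toFun x := ha
  have hb' : ∀ᵐ y ∂ν, b.toFun y = b'.toFun y := hb
  filter_upwards [ha', a.mp_toFun.quasiMeasurePreserving.ae hb'] with x h1 h2
  simp [h2, ← h1]

end IsoRep

/-- Isomorphisms of measure spaces `(X, μ) → (Y, ν)`, modulo equality almost everywhere. -/
def ProbIso (μ : Measure X) (ν : Measure Y) := Quotient (IsoRep.setoid μ ν)

namespace ProbIso

variable {μ : Measure X} {ν : Measure Y} {ξ : Measure Z}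

/-- The class of a representative. -/
def mk (a : IsoRep μ ν) : ProbIso μ ν := Quotient.mk _ a

/-- The inverse isomorphism. -/
def symm (Δ : ProbIso μ ν) : ProbIso ν μ :=
  Quotient.map IsoRep.symm (fun _ _ h => IsoRep.symm_congr h) Δ

/-- The composition, first `Δ` and then `Θ`. -/
def trans (Δ : ProbIso μ ν) (Θ : ProbIso ν ξ) : ProbIso μ ξ :=
  Quotient.map₂ IsoRep.trans (fun _ _ h _ _ h' => IsoRep.trans_congr h h') Δ Θ

/-- The induced map `Δ_* : L^∞(X, μ) → L^∞(Y, ν)`, `Δ_* f = f ∘ Δ⁻¹`. -/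
noncomputable def pushforward (Δ : ProbIso μ ν) : LInfty μ → LInfty ν :=
  Quotient.lift (fun a : IsoRep μ ν => LInfty.comp a.invFun a.mp_invFun)
    (fun a b h => by
      funext f
      exact Subtype.ext (AEEqFun.compMeasurePreserving_congr _ a.mp_invFun
        b.mp_invFun.measurable (IsoRep.symm_congr h))) Δ

end ProbIso

/-- `Aut(X, μ)`: the group of automorphisms of `(X, μ)` modulo equality almost everywhere, with
composition of maps as the product. -/
abbrev Aut (μ : Measure X) := ProbIso μ μ

instance instGroupAut (μ : Measure X) : Group (Aut μ) where
  mul Δ Θ := Θ.trans Δ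
  one := ProbIso.mk (IsoRep.refl μ)
  inv Δ := Δ.symm
  mul_assoc Δ Θ Ξ := by
    induction Δ using Quotient.ind
    induction Θ using Quotient.ind
    induction Ξ using Quotient.ind
    rfl
  one_mul Δ := by
    induction Δ using Quotient.ind
    rfl
  mul_one Δ := by
    induction Δ using Quotient.ind
    rfl
  inv_mul_cancel Δ := by
    induction Δ using Quotient.ind with
    | _ a => exact Quotient.sound a.left_inv

/-- Conjugation `φ ↦ Δ ∘ φ ∘ Δ⁻¹`, as a homomorphism `Aut(X, μ) → Aut(Y, ν)`. -/
def ProbIso.conj {μ : Measure X} {ν : Measure Y} (Δ : ProbIso μ ν) : Aut μ →* Aut ν where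
  toFun φ := Δ.symm.trans (φ.trans Δ)
  map_one' := by
    induction Δ using Quotient.ind with
    | _ a => exact Quotient.sound a.right_inv
  map_mul' φ ψ := by
    induction Δ using Quotient.ind with
    | _ a =>
    induction φ using Quotient.ind with
    | _ f =>
    induction ψ using Quotient.ind with
    | _ g =>
    refine Quotient.sound ?_
    change a.toFun ∘ (f.toFun ∘ g.toFun) ∘ a.invFun =ᵐ[ν]
      (a.toFun ∘ f.toFun ∘ a.invFun) ∘ (a.toFun ∘ g.toFun ∘ a.invFun)
    filter_upwards [a.mp_invFun.quasiMeasurePreserving.ae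
      (g.mp_toFun.quasiMeasurePreserving.ae a.left_inv)] with y h
    simp [h]

/-- Let `G < Aut(X, μ)` and `H < Aut(Y, ν)`. The isomorphism `Δ : (X, μ) → (Y, ν)` is a
commensuration of `G` and `H` if `G ∩ Δ⁻¹ H Δ` has finite index in `G` and `H ∩ Δ G Δ⁻¹` has
finite index in `H`. -/
def IsCommensuration {μ : Measure X} {ν : Measure Y} (G : Subgroup (Aut μ)) (H : Subgroup (Aut ν))
    (Δ : ProbIso μ ν) : Prop :=
  (H.comap Δ.conj).IsFiniteRelIndex G ∧ (G.map Δ.conj).IsFiniteRelIndex H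

end ProbIso

/-! ### Generalized Bernoulli actions -/

section Bernoulli

variable {X₀ : Type*} [MeasurableSpace X₀]

/-- The product probability measure `μ₀^I` on `X₀^I`. -/
noncomputable abbrev prodMeasure (I : Type*) (μ₀ : Measure X₀) [IsProbabilityMeasure μ₀] :
    Measure (I → X₀) :=
  Measure.infinitePi fun _ : I => μ₀

theorem measurePreserving_reindex {I : Type*} (μ₀ : Measure X₀) [IsProbabilityMeasure μ₀]
    (e : I ≃ I) :
    MeasurePreserving (fun (x : I → X₀) i => x (e i)) (prodMeasure I μ₀) (prodMeasure I μ₀) where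
  measurable := by fun_prop
  map_eq := by
    have h := Measure.infinitePi_map_piCongrLeft (μ := fun _ : I => μ₀) e.symm
    have h' : (fun (x : I → X₀) i => x (e i)) =
        MeasurableEquiv.piCongrLeft (fun _ : I => X₀) e.symm := by
      funext x i
      obtain ⟨k, rfl⟩ := e.symm.surjective i
      simp [MeasurableEquiv.coe_piCongrLeft, Equiv.piCongrLeft_apply_apply]
    rw [h']
    exact h

/-- The generalized Bernoulli action `Γ ↷ (X₀, μ₀)^I` of an action `Γ ↷ I`, as a homomorphism
`Γ → Aut(X₀^I, μ₀^I)`: the element `g` acts by `(g x)_i = x_{g⁻¹ i}`. -/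
noncomputable def bernoulli (Γ I : Type*) [Group Γ] [MulAction Γ I]
    (μ₀ : Measure X₀) [IsProbabilityMeasure μ₀] : Γ →* Aut (prodMeasure I μ₀) where
  toFun g := ProbIso.mk
    { toFun := fun x i => x (g⁻¹ • i)
      invFun := fun x i => x (g • i)
      mp_toFun := measurePreserving_reindex μ₀ (MulAction.toPerm g⁻¹)
      mp_invFun := measurePreserving_reindex μ₀ (MulAction.toPerm g)
      left_inv := by simp
      right_inv := by simp }
  map_one' := by
    refine Quotient.sound (Eventually.of_forall fun x => ?_)
    simp [IsoRep.refl]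
  map_mul' g h := by
    refine Quotient.sound (Eventually.of_forall fun x => ?_)
    simp [IsoRep.trans, Function.comp_def, mul_smul]

/-- The embedding `π_i : L^∞(X₀, μ₀) → L^∞((X₀, μ₀)^I)`, `π_i(f)(x) = f(x_i)`. -/
noncomputable def coordEmb {I : Type*} (μ₀ : Measure X₀) [IsProbabilityMeasure μ₀] (i : I) :
    LInfty μ₀ → LInfty (prodMeasure I μ₀) :=
  LInfty.comp (Function.eval i) (measurePreserving_eval_infinitePi (fun _ : I => μ₀) i)

end Bernoulli

section Actions

/-- For every `i`, the stabilizer of `i` acts with infinite orbits on `I \ {i}`. -/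
def StabInfiniteOrbits (Γ I : Type*) [Group Γ] [MulAction Γ I] : Prop :=
  ∀ i k : I, k ≠ i → (MulAction.orbit (MulAction.stabilizer Γ i) k).Infinite

/-- The bijection `η : I → J` is a commensuration of `Γ ↷ I` and `Λ ↷ J`, with respect to the
isomorphism `δ` between the finite index subgroups `Γ₁ < Γ` and `Λ₁ < Λ`. -/
structure IsBijCommensuration {Γ Λ I J : Type*} [Group Γ] [Group Λ] [MulAction Γ I]
    [MulAction Λ J] (Γ₁ : Subgroup Γ) (Λ₁ : Subgroup Λ) (δ : Γ₁ ≃* Λ₁) (η : I ≃ J) : Prop where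
  finiteIndex_left : Γ₁.FiniteIndex
  finiteIndex_right : Λ₁.FiniteIndex
  map_smul : ∀ (g : Γ₁) (i : I), η ((g : Γ) • i) = (δ g : Λ) • η i

/-- The relation `Δ_* ∘ π_i = π_{η(i)} ∘ α_{ī}` for all `i`, where `ī` is the class of `i` in
`Γ₁ \ I`. -/
def IsImplementedBy {Γ I J X₀ Y₀ : Type*} [Group Γ] [MulAction Γ I]
    [MeasurableSpace X₀] [MeasurableSpace Y₀]
    {μ₀ : Measure X₀} [IsProbabilityMeasure μ₀] {ν₀ : Measure Y₀} [IsProbabilityMeasure ν₀]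
    (Δ : ProbIso (prodMeasure I μ₀) (prodMeasure J ν₀))
    (Γ₁ : Subgroup Γ) (η : I ≃ J)
    (α : MulAction.orbitRel.Quotient Γ₁ I → (LInfty μ₀ ≃⋆ₐ[ℂ] LInfty ν₀)) : Prop :=
  ∀ (i : I) (f : LInfty μ₀),
    Δ.pushforward (coordEmb μ₀ i f) =
      coordEmb ν₀ (η i) (α (Quotient.mk (MulAction.orbitRel Γ₁ I) i) f)

end Actions

end GenBernoulli

/-! A trace preserving `*`-isomorphism between the algebras of two standard probability spaces comes
from a point isomorphism (`IsTracePreserving.exists_isoRep`). The relation `IsImplementedBy`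
therefore says that coordinate `i` of the inverse of `Δ` is a function of coordinate `η i` alone
(`isImplementedBy_mk_iff`). Since `I` is countable, this determines `Δ` almost everywhere and allows
it to be built coordinatewise. The base maps are constant on `Γ₁`-orbits, so `Δ` conjugates `g` to
`δ g` and is a commensuration.

Conversely, a commensuration conjugates a finite index subgroup `Γ₁` onto a finite index subgroup
`Λ₁`. Let `Γ₁` act on `J` through this isomorphism; `Δ` becomes equivariant, and both index actions
keep infinite orbits for stabilizers. The main tool is `ae_eq_mergeOn_of_invariant`: a function
invariant under a group that fixes `T` pointwise and has infinite orbits off `T` depends only on the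
coordinates in `T`.

For `T` empty this is ergodicity. Coordinate `i`, carried to the `J` side, is invariant under the
stabilizer of `i` and not constant, so that stabilizer has a finite orbit on `J`, say that of `j`.
The intersection of the stabilizers of `i` and `j` then has finite index in the stabilizer of `i`.
Taking `T = {i}`, coordinate `j` of the image depends only on coordinate `i`. The same argument for
the inverse, together with the fact that distinct coordinates do not determine each other, turns
this matching into an equivariant bijection `η`. -/

namespace GenBernoulli

/-! ### Infinite orbits, relative indices and displacement of finite sets -/

section Groups

open MulAction
open scoped Pointwise

variable {G I : Type*} [Group G] [MulAction G I]

/-- By orbit-stabilizer, with infinite index and infinite cardinality both recorded as `0`. In this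
form, passing to finite index subgroups is index arithmetic. -/
theorem relIndex_stabilizer_eq_zero_iff (K : Subgroup G) (k : I) :
    (stabilizer G k).relIndex K = 0 ↔ (orbit K k).Infinite := by
  have h : (stabilizer G k).subgroupOf K = stabilizer K k := by
    ext g; simp [Subgroup.mem_subgroupOf, mem_stabilizer_iff, Subgroup.smul_def]
  rw [Subgroup.relIndex, h, index_stabilizer]
  exact ⟨fun h0 hf => (nonempty_orbit k).ne_empty ((Set.ncard_eq_zero hf).1 h0), Set.Infinite.ncard⟩

theorem StabInfiniteOrbits.relIndex_eq_zero (h : StabInfiniteOrbits G I) {i k : I} (hk : k ≠ i) :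
    (stabilizer G k).relIndex (stabilizer G i) = 0 :=
  (relIndex_stabilizer_eq_zero_iff _ _).2 (h i k hk)

theorem stabInfiniteOrbits_iff : StabInfiniteOrbits G I ↔
    ∀ i k : I, k ≠ i → (stabilizer G k).relIndex (stabilizer G i) = 0 :=
  ⟨fun h _ _ hk => h.relIndex_eq_zero hk,
    fun h i k hk => (relIndex_stabilizer_eq_zero_iff _ _).1 (h i k hk)⟩

/-- Infinite orbits persist for subgroups of finite relative index. -/
theorem relIndex_eq_zero_of_relIndex_ne_zero {S K L : Subgroup G} (h : S.relIndex L = 0)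
    (hK : K.relIndex L ≠ 0) : S.relIndex K = 0 := by
  by_contra h'
  exact Subgroup.relIndex_ne_zero_trans h' hK h

/-- B. H. Neumann's lemma: a group acting with infinite orbits moves any finite set off itself. -/
theorem exists_smul_notMem_of_infinite_orbits (K : Subgroup G) (F : Finset I)
    (hF : ∀ k ∈ F, (stabilizer G k).relIndex K = 0) (E : Finset I) :
    ∃ g ∈ K, ∀ k ∈ F, g • k ∉ E := by
  classical
  by_contra! hcon
  let P : Finset (I × I) := (F ×ˢ E).filter fun p => ∃ g : K, g • p.1 = p.2
  let c : I × I → K := fun p => if h : ∃ g : K, g • p.1 = p.2 then h.choose else 1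
  have hc : ∀ p ∈ P, c p • p.1 = p.2 := by
    intro p hp
    have h := (Finset.mem_filter.1 hp).2
    simp only [c, dif_pos h]
    exact h.choose_spec
  -- The coset attached to `(k, e)` is the set of all elements of `K` sending `k` to `e`. If no
  -- element displaces `F` from `E`, these finitely many cosets cover `K`, so one of the stabilizers
  -- has finite index.
  have hcover : ⋃ p ∈ P, c p • ((stabilizer K p.1 : Subgroup K) : Set K) = Set.univ := by
    refine Set.eq_univ_of_forall fun g => ?_
    obtain ⟨k, hk, hgk⟩ := hcon g g.2
    have hp : (k, (g : G) • k) ∈ P := Finset.mem_filter.2 ⟨Finset.mk_mem_product hk hgk, g, rfl⟩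
    refine Set.mem_biUnion hp ?_
    rw [Set.mem_smul_set_iff_inv_smul_mem]
    have := hc _ hp
    simp only [smul_eq_mul, SetLike.mem_coe, mem_stabilizer_iff, mul_smul]
    rw [inv_smul_eq_iff, this]
    rfl
  obtain ⟨p, hp, hfin⟩ := Subgroup.exists_finiteIndex_of_leftCoset_cover hcover
  have h0 := hF p.1 (Finset.mem_product.1 (Finset.mem_filter.1 hp).1).1
  rw [relIndex_stabilizer_eq_zero_iff] at h0
  have := hfin.index_ne_zero
  rw [index_stabilizer] at this
  exact this h0.ncard

end Groups

/-! ### Resampling coordinates and invariant functions on product spaces -/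

section Product

variable {I X₀ : Type*}

open Classical in
/-- The point of `X₀ ^ I` whose coordinates are those of `p.1` on `S` and those of `p.2` off `S`. -/
noncomputable def mergeOn (S : Set I) (p : (I → X₀) × (I → X₀)) : I → X₀ :=
  fun l => if l ∈ S then p.1 l else p.2 l

theorem mergeOn_of_mem {S : Set I} {l : I} (h : l ∈ S) (p : (I → X₀) × (I → X₀)) :
    mergeOn S p l = p.1 l := if_pos h

theorem mergeOn_of_notMem {S : Set I} {l : I} (h : l ∉ S) (p : (I → X₀) × (I → X₀)) :
    mergeOn S p l = p.2 l := if_neg h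

variable [MeasurableSpace X₀]

theorem measurable_mergeOn (S : Set I) : Measurable (mergeOn (X₀ := X₀) S) := by
  refine measurable_pi_lambda _ fun l => ?_
  by_cases h : l ∈ S
  · simp only [mergeOn_of_mem h]; fun_prop
  · simp only [mergeOn_of_notMem h]; fun_prop

/-- Independence of the coordinates in `S` from the others: a box pulls back to a product of a box
over `S` and a box over the complement. -/
theorem measurePreserving_mergeOn (μ₀ : Measure X₀) [IsProbabilityMeasure μ₀] (S : Set I) :
    MeasurePreserving (mergeOn S) ((prodMeasure I μ₀).prod (prodMeasure I μ₀))
      (prodMeasure I μ₀) where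
  measurable := measurable_mergeOn S
  map_eq := by
    classical
    refine Measure.eq_infinitePi _ fun s t ht => ?_
    rw [Measure.map_apply (measurable_mergeOn S) (.pi s.countable_toSet fun _ _ => ht _)]
    have h : mergeOn S ⁻¹' (s : Set I).pi t =
        (((s.filter (· ∈ S) : Finset I) : Set I).pi t) ×ˢ
          (((s.filter (· ∉ S) : Finset I) : Set I).pi t) := by
      ext p
      simp only [Set.mem_preimage, Set.mem_pi, Set.mem_prod, Finset.coe_filter, Set.mem_ofPred_eq,
        Finset.mem_coe]
      constructor
      · exact fun h => ⟨fun i hi => by simpa [mergeOn_of_mem hi.2] using h i hi.1,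
          fun i hi => by simpa [mergeOn_of_notMem hi.2] using h i hi.1⟩
      · rintro ⟨h1, h2⟩ i hi
        by_cases hS : i ∈ S
        · rw [mergeOn_of_mem hS]; exact h1 i ⟨hi, hS⟩
        · rw [mergeOn_of_notMem hS]; exact h2 i ⟨hi, hS⟩
    rw [h, Measure.prod_prod, Measure.infinitePi_pi _ fun i _ => ht i,
      Measure.infinitePi_pi _ fun i _ => ht i, Finset.prod_filter_mul_prod_filter_not]

variable {G : Type*} [Group G] [MulAction G I]

/-- Approximate `A` by a cylinder `B` over a finite set `F`, and let `g ∈ K` move `F \ T` off `F`.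
For `B`, resampling the coordinates off `T` has the same joint law as translating by `g`, because
the coordinates read before and after are independent off `T`. Invariance of `A` makes the
translation almost invisible. -/
theorem prod_measure_mem_notMem_mergeOn_eq_zero (μ₀ : Measure X₀) [IsProbabilityMeasure μ₀]
    (K : Subgroup G) (T : Set I) (hT : ∀ g ∈ K, ∀ t ∈ T, g • t = t)
    (hK : ∀ k ∉ T, (MulAction.stabilizer G k).relIndex K = 0)
    {A : Set (I → X₀)} (hA : MeasurableSet A)
    (hinv : ∀ g ∈ K, ∀ᵐ x ∂prodMeasure I μ₀, (fun i => x (g • i)) ∈ A ↔ x ∈ A) :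
    ((prodMeasure I μ₀).prod (prodMeasure I μ₀)) {p | p.1 ∈ A ∧ mergeOn T p ∉ A} = 0 := by
  classical
  set μ := prodMeasure I μ₀
  have key : ∀ ε : ℝ≥0∞, 0 < ε → (μ.prod μ) {p | p.1 ∈ A ∧ mergeOn T p ∉ A} ≤ 4 * ε := by
    intro ε hε
    obtain ⟨B, hB, hBA⟩ := exists_measure_symmDiff_lt_of_generateFrom_isSetRing (μ := μ)
      (isSetAlgebra_measurableCylinders (α := fun _ : I => X₀)).isSetRing
      ⟨{Set.univ}, by simp, by simpa using univ_mem_measurableCylinders fun _ : I => X₀, by simp⟩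
      generateFrom_measurableCylinders.symm hA hε
    obtain ⟨F, S, hS, rfl⟩ := (mem_measurableCylinders B).1 hB
    set B := cylinder (α := fun _ : I => X₀) F S
    have hBm : MeasurableSet B := hS.cylinder
    have hD : MeasurableSet (symmDiff B A) := hBm.symmDiff hA
    obtain ⟨g, hg, hgF⟩ := exists_smul_notMem_of_infinite_orbits K (F.filter (· ∉ T))
      (fun k hk => hK k (Finset.mem_filter.1 hk).2) F
    -- Landing in `T` is impossible because `g⁻¹` fixes `T` pointwise.
    have hgT : ∀ k ∈ F, k ∉ T → g • k ∉ (F : Set I) ∪ T := by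
      rintro k hk hkT (h | h)
      · exact hgF k (Finset.mem_filter.2 ⟨hk, hkT⟩) h
      · have := hT _ (K.inv_mem hg) _ h
        rw [inv_smul_smul] at this
        exact hkT (this ▸ h)
    have mps : ∀ h : G, MeasurePreserving (fun (x : I → X₀) i => x (h • i)) μ μ := fun h =>
      measurePreserving_reindex μ₀ (MulAction.toPerm h)
    -- The single point `w` equal to `x` on `F ∪ T` and to the translate of `y` elsewhere encodes
    -- both tests: its `F`-coordinates are those of `x`, and those of its translate by `g` are the
    -- ones of the merged point.
    have mpW : MeasurePreserving
        (fun p : (I → X₀) × (I → X₀) => mergeOn ((F : Set I) ∪ T) (p.1, fun i => p.2 (g⁻¹ • i)))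
        (μ.prod μ) μ :=
      (measurePreserving_mergeOn μ₀ _).comp ((MeasurePreserving.id μ).prod (mps g⁻¹))
    have h1 : {p : (I → X₀) × (I → X₀) | p.1 ∈ B ∧ mergeOn T p ∉ B} =
        (fun p : (I → X₀) × (I → X₀) =>
          mergeOn ((F : Set I) ∪ T) (p.1, fun i => p.2 (g⁻¹ • i))) ⁻¹'
          {x | x ∈ B ∧ (fun i => x (g • i)) ∉ B} := by
      ext p
      have e1 : F.restrict p.1 =
          F.restrict (mergeOn ((F : Set I) ∪ T) (p.1, fun i => p.2 (g⁻¹ • i))) := by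
        ext k
        simp only [Finset.restrict]
        rw [mergeOn_of_mem (Set.mem_union_left T (Finset.mem_coe.2 k.2))]
      have e2 : F.restrict (mergeOn T p) =
          F.restrict fun i =>
            mergeOn ((F : Set I) ∪ T) (p.1, fun i => p.2 (g⁻¹ • i)) (g • i) := by
        ext k
        simp only [Finset.restrict]
        by_cases hk : (k : I) ∈ T
        · rw [hT g hg _ hk, mergeOn_of_mem hk, mergeOn_of_mem (Set.mem_union_right _ hk)]
        · rw [mergeOn_of_notMem hk, mergeOn_of_notMem (hgT _ k.2 hk)]
          simp only [inv_smul_smul]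
      simp only [B, Set.mem_ofPred_eq, Set.mem_preimage, mem_cylinder] at e1 e2 ⊢
      rw [e1, e2]
    have hsub1 : {x : I → X₀ | x ∈ B ∧ (fun i => x (g • i)) ∉ B} ⊆
        symmDiff B A ∪ ((fun (x : I → X₀) i => x (g • i)) ⁻¹' symmDiff B A) ∪
          {x | ¬ ((fun i => x (g • i)) ∈ A ↔ x ∈ A)} := by
      intro x hx
      simp only [Set.mem_union, Set.mem_symmDiff, Set.mem_preimage, Set.mem_ofPred_eq] at hx ⊢
      tauto
    have hsub2 : {p : (I → X₀) × (I → X₀) | p.1 ∈ A ∧ mergeOn T p ∉ A} ⊆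
        {p | p.1 ∈ B ∧ mergeOn T p ∉ B} ∪ Prod.fst ⁻¹' symmDiff B A ∪
          mergeOn T ⁻¹' symmDiff B A := by
      intro p hp
      simp only [Set.mem_union, Set.mem_symmDiff, Set.mem_preimage, Set.mem_ofPred_eq] at hp ⊢
      tauto
    have hmeas : MeasurableSet {x : I → X₀ | x ∈ B ∧ (fun i => x (g • i)) ∉ B} :=
      hBm.inter ((mps g).measurable hBm).compl
    -- Two errors come from replacing `A` by `B` at the two points of the pair, and two more from
    -- comparing `B` and its translate with the invariant set `A`.
    calc (μ.prod μ) {p | p.1 ∈ A ∧ mergeOn T p ∉ A}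
        ≤ (μ.prod μ) {p | p.1 ∈ B ∧ mergeOn T p ∉ B} + (μ.prod μ) (Prod.fst ⁻¹' symmDiff B A) +
          (μ.prod μ) (mergeOn T ⁻¹' symmDiff B A) :=
          (measure_mono hsub2).trans ((measure_union_le _ _).trans
            (add_le_add_left (measure_union_le _ _) _))
      _ = μ {x | x ∈ B ∧ (fun i => x (g • i)) ∉ B} + μ (symmDiff B A) + μ (symmDiff B A) := by
          rw [h1, mpW.measure_preimage hmeas.nullMeasurableSet,
            measurePreserving_fst.measure_preimage hD.nullMeasurableSet,
            (measurePreserving_mergeOn μ₀ T).measure_preimage hD.nullMeasurableSet]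
      _ ≤ (μ (symmDiff B A) + μ (symmDiff B A) + 0) + μ (symmDiff B A) + μ (symmDiff B A) := by
          gcongr
          refine (measure_mono hsub1).trans ((measure_union_le _ _).trans (add_le_add
            ((measure_union_le _ _).trans (add_le_add le_rfl ?_)) ?_))
          · exact ((mps g).measure_preimage hD.nullMeasurableSet).le
          · exact (ae_iff.1 (hinv g hg)).le
      _ ≤ (ε + ε + 0) + ε + ε := by gcongr
      _ = 4 * ε := by ring
  refine le_antisymm (ENNReal.le_of_forall_pos_le_add fun ε hε _ => ?_) zero_le
  have := key (ε / 4) (by simpa using hε.ne')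
  rwa [ENNReal.mul_div_cancel (by norm_num) (by norm_num), ← zero_add (ε : ℝ≥0∞)] at this

/-- A function invariant under a group that fixes `T` pointwise and has infinite orbits off `T` only
depends on the coordinates in `T`. -/
theorem ae_eq_mergeOn_of_invariant {Z : Type*} [MeasurableSpace Z]
    [MeasurableSpace.CountablySeparated Z] (μ₀ : Measure X₀) [IsProbabilityMeasure μ₀]
    (K : Subgroup G) (T : Set I) (hT : ∀ g ∈ K, ∀ t ∈ T, g • t = t)
    (hK : ∀ k ∉ T, (MulAction.stabilizer G k).relIndex K = 0)
    {f : (I → X₀) → Z} (hf : Measurable f)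
    (hinv : ∀ g ∈ K, ∀ᵐ x ∂prodMeasure I μ₀, f (fun i => x (g • i)) = f x) :
    ∀ᵐ p ∂(prodMeasure I μ₀).prod (prodMeasure I μ₀), f (mergeOn T p) = f p.1 := by
  refine EventuallyEq.of_forall_separating_mem_iff MeasurableSet fun A hA => ?_
  have h : ∀ A : Set Z, MeasurableSet A →
      ∀ᵐ p ∂(prodMeasure I μ₀).prod (prodMeasure I μ₀), f p.1 ∈ A → f (mergeOn T p) ∈ A := by
    intro A hA
    have := prod_measure_mem_notMem_mergeOn_eq_zero μ₀ K T hT hK (hf hA) fun g hg => by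
      filter_upwards [hinv g hg] with x hx
      simp [hx]
    simpa [ae_iff] using this
  -- Membership is only known to propagate one way; the complement gives the converse.
  filter_upwards [h A hA, h Aᶜ hA.compl] with p h1 h2
  exact ⟨fun h => by_contra fun h' => h2 h' h, h1⟩

/-- Fubini allows the resampled coordinates to be frozen at one `y`. The swap is there to make `y`
the outer variable. -/
theorem exists_ae_eq_mergeOn_of_invariant {Z : Type*} [MeasurableSpace Z]
    [MeasurableSpace.CountablySeparated Z] (μ₀ : Measure X₀) [IsProbabilityMeasure μ₀]
    (K : Subgroup G) (T : Set I) (hT : ∀ g ∈ K, ∀ t ∈ T, g • t = t)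
    (hK : ∀ k ∉ T, (MulAction.stabilizer G k).relIndex K = 0)
    {f : (I → X₀) → Z} (hf : Measurable f)
    (hinv : ∀ g ∈ K, ∀ᵐ x ∂prodMeasure I μ₀, f (fun i => x (g • i)) = f x) :
    ∃ y : I → X₀, ∀ᵐ x ∂prodMeasure I μ₀, f x = f (mergeOn T (x, y)) := by
  have h := Measure.ae_ae_of_ae_prod
    ((Measure.measurePreserving_swap (μ := prodMeasure I μ₀)
      (ν := prodMeasure I μ₀)).quasiMeasurePreserving.ae
        (ae_eq_mergeOn_of_invariant μ₀ K T hT hK hf hinv))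
  obtain ⟨y, hy⟩ := h.exists
  exact ⟨y, hy.mono fun x hx => hx.symm⟩

/-- Ergodicity: if all orbits are infinite, then invariant functions are constant. -/
theorem exists_ae_eq_const_of_invariant {Z : Type*} [MeasurableSpace Z]
    [MeasurableSpace.CountablySeparated Z] (μ₀ : Measure X₀) [IsProbabilityMeasure μ₀]
    (K : Subgroup G) (hK : ∀ k : I, (MulAction.stabilizer G k).relIndex K = 0)
    {f : (I → X₀) → Z} (hf : Measurable f)
    (hinv : ∀ g ∈ K, ∀ᵐ x ∂prodMeasure I μ₀, f (fun i => x (g • i)) = f x) :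
    ∃ c : Z, ∀ᵐ x ∂prodMeasure I μ₀, f x = c := by
  obtain ⟨y, hy⟩ := exists_ae_eq_mergeOn_of_invariant μ₀ K ∅ (by simp) (fun k _ => hK k) hf hinv
  refine ⟨f y, hy.mono fun x hx => hx.trans (congrArg f ?_)⟩
  funext l
  exact mergeOn_of_notMem (by simp) _

/-- If a group fixes `i` and has infinite orbits on the other indices, then invariant functions only
depend on the coordinate `i`. -/
theorem exists_ae_eq_comp_eval_of_invariant {Z : Type*} [MeasurableSpace Z]
    [MeasurableSpace.CountablySeparated Z] (μ₀ : Measure X₀) [IsProbabilityMeasure μ₀]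
    (K : Subgroup G) (i : I) (hi : ∀ g ∈ K, g • i = i)
    (hK : ∀ k : I, k ≠ i → (MulAction.stabilizer G k).relIndex K = 0)
    {f : (I → X₀) → Z} (hf : Measurable f)
    (hinv : ∀ g ∈ K, ∀ᵐ x ∂prodMeasure I μ₀, f (fun i => x (g • i)) = f x) :
    ∃ θ : X₀ → Z, Measurable θ ∧ ∀ᵐ x ∂prodMeasure I μ₀, f x = θ (x i) := by
  classical
  obtain ⟨y, hy⟩ := exists_ae_eq_mergeOn_of_invariant μ₀ K {i} (by simpa using hi)
    (fun k hk => hK k hk) hf hinv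
  refine ⟨fun t => f (Function.update y i t), hf.comp (measurable_update y), ?_⟩
  refine hy.mono fun x hx => hx.trans (congrArg f ?_)
  funext l
  by_cases hl : l = i
  · subst hl
    rw [mergeOn_of_mem (Set.mem_singleton l), Function.update_self]
  · rw [mergeOn_of_notMem (by simpa using hl), Function.update_of_ne hl]

end Product

/-! ### Nontrivial base spaces and independence of coordinates -/

section NonAtomic

/-- If every measurable set were null or conull, countable separation would make the identity almost
everywhere constant, giving an atom of mass one. -/
theorem exists_measurableSet_measure_ne_zero_ne_one {X : Type*} [MeasurableSpace X]
    [StandardBorelSpace X] (μ : Measure X) [IsProbabilityMeasure μ] (hμ : ∀ x, μ {x} ≠ 1) :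
    ∃ A, MeasurableSet A ∧ μ A ≠ 0 ∧ μ Aᶜ ≠ 0 := by
  by_contra! h
  have := nonempty_of_isProbabilityMeasure μ
  obtain ⟨c, hc⟩ := exists_eventuallyEq_const_of_forall_separating (l := ae μ) (f := id)
    MeasurableSet fun A hA => by
      by_cases h0 : μ A = 0
      · exact Or.inr (measure_eq_zero_iff_ae_notMem.1 h0)
      · exact Or.inl (ae_iff.2 (h A hA h0))
  refine hμ c ?_
  rw [← prob_compl_eq_zero_iff (measurableSet_singleton c)]
  exact ae_iff.1 hc

theorem measurePreserving_of_ae_eq_comp_eval {I X₀ Z : Type*} [MeasurableSpace X₀]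
    [MeasurableSpace Z] {μ₀ : Measure X₀} [IsProbabilityMeasure μ₀] {ξ : Measure Z}
    {f : (I → X₀) → Z} (hf : MeasurePreserving f (prodMeasure I μ₀) ξ) {θ : X₀ → Z}
    (hθ : Measurable θ) {i : I} (h : ∀ᵐ x ∂prodMeasure I μ₀, f x = θ (x i)) :
    MeasurePreserving θ μ₀ ξ where
  measurable := hθ
  map_eq := by
    have hi := measurePreserving_eval_infinitePi (fun _ : I => μ₀) i
    rw [← hi.map_eq, Measure.map_map hθ hi.measurable, ← hf.map_eq]
    exact Measure.map_congr (h.mono fun x hx => hx.symm)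

/-- Distinct coordinates do not determine each other. -/
theorem eq_of_ae_eq_comp_eval {I X₀ : Type*} [MeasurableSpace X₀] [StandardBorelSpace X₀]
    (μ₀ : Measure X₀) [IsProbabilityMeasure μ₀] (hμ₀ : ∀ x, μ₀ {x} ≠ 1) {θ : X₀ → X₀}
    (hθ : Measurable θ) {i k : I} (h : ∀ᵐ x ∂prodMeasure I μ₀, x k = θ (x i)) : k = i := by
  classical
  by_contra hki
  obtain ⟨A, hA, h0, h1⟩ := exists_measurableSet_measure_ne_zero_ne_one μ₀ hμ₀
  have hmp := measurePreserving_of_ae_eq_comp_eval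
    (measurePreserving_eval_infinitePi (fun _ : I => μ₀) k) hθ h
  -- The event `x k ∈ A`, `θ (x i) ∉ A` is null by hypothesis, yet by independence it has measure
  -- `μ₀ A * μ₀ Aᶜ`.
  have hnull : prodMeasure I μ₀ (((({k, i} : Finset I) : Set I)).pi
      fun l => if l = k then A else θ ⁻¹' Aᶜ) = 0 := by
    refine measure_mono_null (fun x hx => ?_) (ae_iff.1 h)
    have hk := hx k (by simp)
    have hi := hx i (by simp)
    simp only [if_true, Ne.symm hki, if_false] at hk hi
    intro he
    exact hi (he ▸ hk)
  rw [Measure.infinitePi_pi, Finset.prod_pair hki] at hnull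
  · simp only [if_true, Ne.symm hki, if_false, mul_eq_zero] at hnull
    rw [hmp.measure_preimage hA.compl.nullMeasurableSet] at hnull
    exact hnull.elim h0 h1
  · intro l _
    split_ifs
    exacts [hA, hθ hA.compl]

end NonAtomic

/-! ### Point realization of measure algebra homomorphisms -/

section PointRealization

variable {X Y : Type*} [MeasurableSpace X] [MeasurableSpace Y]

/-- A measure preserving homomorphism of measure algebras into a standard Borel space is induced by
a point map. -/
theorem exists_measurePreserving_preimage_ae_eq [StandardBorelSpace Y] (μ : Measure X)
    [IsProbabilityMeasure μ] (ν : Measure Y) [IsProbabilityMeasure ν] (B : Set Y → Set X)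
    (hmeas : ∀ A, MeasurableSet A → MeasurableSet (B A))
    (hcompl : ∀ A, MeasurableSet A → B Aᶜ =ᵐ[μ] (B A)ᶜ)
    (hinter : ∀ A A', MeasurableSet A → MeasurableSet A' → B (A ∩ A') =ᵐ[μ] (B A ∩ B A' : Set X))
    (hμ : ∀ A, MeasurableSet A → μ (B A) = ν A) :
    ∃ φ : X → Y, MeasurePreserving φ μ ν ∧ ∀ A, MeasurableSet A → φ ⁻¹' A =ᵐ[μ] B A := by
  classical
  have hunion : ∀ A A', MeasurableSet A → MeasurableSet A' →
      B (A ∪ A') =ᵐ[μ] (B A ∪ B A' : Set X) := by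
    intro A A' hA hA'
    have e : A ∪ A' = (Aᶜ ∩ A'ᶜ)ᶜ := by rw [Set.compl_inter, compl_compl, compl_compl]
    have e' : B A ∪ B A' = ((B A)ᶜ ∩ (B A')ᶜ)ᶜ := by
      rw [Set.compl_inter, compl_compl, compl_compl]
    rw [e, e']
    exact (hcompl _ (hA.compl.inter hA'.compl)).trans
      ((hinter _ _ hA.compl hA'.compl).trans ((hcompl A hA).inter (hcompl A' hA'))).compl
  have hempty : B ∅ =ᵐ[μ] (∅ : Set X) := by
    rw [ae_eq_empty, hμ _ .empty, measure_empty]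
  have haccm : ∀ A : ℕ → Set Y, (∀ n, MeasurableSet (A n)) → ∀ n,
      MeasurableSet (Set.accumulate A n) := fun A hA n => .biUnion (Set.to_countable _) fun i _ => hA i
  have hacc : ∀ A : ℕ → Set Y, (∀ n, MeasurableSet (A n)) → ∀ n,
      B (Set.accumulate A n) =ᵐ[μ] Set.accumulate (fun n => B (A n)) n := by
    intro A hA n
    induction n with
    | zero => simp only [Set.accumulate_zero_nat]; exact ae_eq_refl _
    | succ n ih =>
      rw [Set.accumulate_succ, Set.accumulate_succ]
      exact (hunion _ _ (haccm A hA n) (hA _)).trans (ih.union (ae_eq_refl _))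
  have hiUnion : ∀ A : ℕ → Set Y, (∀ n, MeasurableSet (A n)) →
      B (⋃ n, A n) =ᵐ[μ] ⋃ n, B (A n) := by
    intro A hA
    have hUm := MeasurableSet.iUnion hA
    have hle : (⋃ n, B (A n)) ≤ᵐ[μ] B (⋃ n, A n) := by
      have h1 : ∀ᵐ x ∂μ, ∀ n, x ∈ B (A n) → x ∈ B (⋃ n, A n) := by
        refine ae_all_iff.2 fun n => ?_
        have h2 := hinter _ _ (hA n) hUm
        rw [Set.inter_eq_left.2 (Set.subset_iUnion A n)] at h2
        filter_upwards [h2.mem_iff] with x hx hxn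
        exact (hx.1 hxn).2
      filter_upwards [h1] with x hx hxU
      obtain ⟨n, hn⟩ := Set.mem_iUnion.1 hxU
      exact hx n hn
    -- Only finite unions are known to be preserved; continuity of measure along the partial unions
    -- forces equality in the countable case.
    refine (ae_eq_of_ae_subset_of_measure_ge hle (le_of_eq ?_)
      (MeasurableSet.iUnion fun n => hmeas _ (hA n)).nullMeasurableSet (measure_ne_top _ _)).symm
    rw [hμ _ hUm, measure_iUnion_eq_iSup_accumulate, measure_iUnion_eq_iSup_accumulate]
    refine iSup_congr fun n => ?_
    rw [← hμ _ (haccm A hA n), measure_congr (hacc A hA n)]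
  obtain ⟨e, hem, hei⟩ := MeasurableSpace.measurable_injection_nat_bool_of_countablySeparated Y
  have hemb : MeasurableEmbedding e := hem.measurableEmbedding hei
  -- Code `Y` inside the Cantor space by `e`; the `n`-th bit of the desired image of `x` is read off
  -- from the set assigned to the `n`-th separating set.
  set h : X → ℕ → Bool := fun x n => decide (x ∈ B {y | e y n = true}) with hh
  have hAm : ∀ n, MeasurableSet {y | e y n = true} := fun n =>
    (measurable_pi_iff.1 hem n) (measurableSet_singleton true)
  have hpre : ∀ n, (fun x => h x n) ⁻¹' {true} = B {y | e y n = true} := by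
    intro n; ext x; simp [hh]
  have hhm : Measurable h := measurable_pi_iff.2 fun n =>
    measurable_to_bool (by rw [hpre]; exact hmeas _ (hAm n))
  have hC : ∀ C, MeasurableSet C → h ⁻¹' C =ᵐ[μ] B (e ⁻¹' C) := by
    let m' : MeasurableSpace (ℕ → Bool) :=
      { MeasurableSet' := fun C => MeasurableSet C ∧ h ⁻¹' C =ᵐ[μ] B (e ⁻¹' C)
        measurableSet_empty := ⟨.empty, by simpa using hempty.symm⟩
        measurableSet_compl := fun C hC => ⟨hC.1.compl, by
          rw [Set.preimage_compl, Set.preimage_compl]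
          exact hC.2.compl.trans (hcompl _ (hem hC.1)).symm⟩
        measurableSet_iUnion := fun C hC => ⟨.iUnion fun n => (hC n).1, by
          rw [Set.preimage_iUnion, Set.preimage_iUnion]
          exact (Filter.EventuallyEq.countable_iUnion fun n => (hC n).2).trans
            (hiUnion _ fun n => hem (hC n).1).symm⟩ }
    -- The good sets form a σ-algebra `m'`; measurability of the identity says that it contains the
    -- product σ-algebra, which need only be checked on coordinates.
    have hle : @Measurable _ _ m' MeasurableSpace.pi (id : (ℕ → Bool) → ℕ → Bool) := by
      refine @measurable_pi_lambda _ _ _ m' _ _ fun n => @measurable_to_bool _ m' _ ⟨?_, ?_⟩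
      · exact (measurable_pi_apply n) (measurableSet_singleton true)
      · change (fun x => h x n) ⁻¹' {true} =ᵐ[μ] _
        rw [hpre]
        exact ae_eq_refl _
    exact fun C hC => (hle hC).2
  have hrange : ∀ᵐ x ∂μ, h x ∈ Set.range e := by
    have h1 : μ (h ⁻¹' (Set.range e)ᶜ) = 0 := by
      rw [measure_congr (hC _ hemb.measurableSet_range.compl)]
      have : e ⁻¹' (Set.range e)ᶜ = ∅ := by ext; simp
      rw [this, measure_congr hempty, measure_empty]
    exact ae_iff.2 h1
  have := nonempty_of_isProbabilityMeasure ν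
  have hinv : Measurable (Function.extend e id fun _ => Classical.arbitrary Y) :=
    hemb.measurable_extend measurable_id measurable_const
  set φ : X → Y := fun x => Function.extend e id (fun _ => Classical.arbitrary Y) (h x) with hφ
  have hφm : Measurable φ := hinv.comp hhm
  have heφ : ∀ᵐ x ∂μ, e (φ x) = h x := by
    filter_upwards [hrange] with x ⟨y, hy⟩
    simp only [hφ]
    rw [← hy, hei.extend_apply, id]
  have hφA : ∀ A, MeasurableSet A → φ ⁻¹' A =ᵐ[μ] B A := by
    intro A hA
    have h1 := hC (e '' A) (hemb.measurableSet_image.2 hA)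
    rw [Set.preimage_image_eq A hei] at h1
    refine EventuallyEq.trans ?_ h1
    filter_upwards [heφ] with x hx
    refine propext ?_
    change φ x ∈ A ↔ h x ∈ e '' A
    rw [← hx, hei.mem_set_image]
  exact ⟨φ, ⟨hφm, Measure.ext fun A hA => by
    rw [Measure.map_apply hφm hA, measure_congr (hφA A hA), hμ A hA]⟩, hφA⟩

end PointRealization

/-! ### Trace preserving `*`-isomorphisms and point isomorphisms -/

section LInftyMaps

variable {X Y : Type*} [MeasurableSpace X] [MeasurableSpace Y] {μ : Measure X} {ν : Measure Y}

namespace LInfty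

theorem ext_ae {f g : LInfty μ} (h : (f : X →ₘ[μ] ℂ) =ᵐ[μ] (g : X →ₘ[μ] ℂ)) : f = g :=
  Subtype.ext (AEEqFun.ext h)

theorem coeFn_mul (f g : LInfty μ) :
    ((f * g : LInfty μ) : X →ₘ[μ] ℂ) =ᵐ[μ]
      fun x => (f : X →ₘ[μ] ℂ) x * (g : X →ₘ[μ] ℂ) x :=
  AEEqFun.coeFn_mul _ _

theorem coeFn_add (f g : LInfty μ) :
    ((f + g : LInfty μ) : X →ₘ[μ] ℂ) =ᵐ[μ]
      fun x => (f : X →ₘ[μ] ℂ) x + (g : X →ₘ[μ] ℂ) x :=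
  AEEqFun.coeFn_add _ _

theorem coeFn_sub (f g : LInfty μ) :
    ((f - g : LInfty μ) : X →ₘ[μ] ℂ) =ᵐ[μ]
      fun x => (f : X →ₘ[μ] ℂ) x - (g : X →ₘ[μ] ℂ) x := by
  have h := coeFn_add (f - g) g
  rw [sub_add_cancel] at h
  filter_upwards [h] with x hx
  rw [hx, add_sub_cancel_right]

theorem coeFn_one : ((1 : LInfty μ) : X →ₘ[μ] ℂ) =ᵐ[μ] fun _ => 1 :=
  AEEqFun.coeFn_one

theorem coeFn_star (f : LInfty μ) :
    ((star f : LInfty μ) : X →ₘ[μ] ℂ) =ᵐ[μ] fun x => star ((f : X →ₘ[μ] ℂ) x) :=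
  AEEqFun.coeFn_star _

theorem coeFn_smul (c : ℂ) (f : LInfty μ) :
    ((c • f : LInfty μ) : X →ₘ[μ] ℂ) =ᵐ[μ] fun x => c • (f : X →ₘ[μ] ℂ) x :=
  AEEqFun.coeFn_smul _ _

theorem coeFn_comp {φ : X → Y} (hφ : MeasurePreserving φ μ ν) (f : LInfty ν) :
    (comp φ hφ f : X →ₘ[μ] ℂ) =ᵐ[μ] fun x => (f : Y →ₘ[ν] ℂ) (φ x) :=
  AEEqFun.coeFn_compMeasurePreserving _ hφ

theorem integrable [IsFiniteMeasure μ] (f : LInfty μ) : Integrable (f : X →ₘ[μ] ℂ) μ :=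
  MemLp.integrable le_top f.2

theorem integral_comp {φ : X → Y} (hφ : MeasurePreserving φ μ ν) (f : LInfty ν) :
    ∫ x, (comp φ hφ f : X →ₘ[μ] ℂ) x ∂μ = ∫ y, (f : Y →ₘ[ν] ℂ) y ∂ν := by
  have h := integral_map (μ := μ) (f := ((f : Y →ₘ[ν] ℂ) : Y → ℂ)) hφ.aemeasurable
    (by rw [hφ.map_eq]; exact AEEqFun.aestronglyMeasurable _)
  rw [integral_congr_ae (coeFn_comp hφ f), ← h, hφ.map_eq]

theorem memLp_indicator_one {A : Set X} (hA : MeasurableSet A) :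
    MemLp (A.indicator fun _ => (1 : ℂ)) ∞ μ :=
  (memLp_top_const 1).indicator hA

/-- The indicator function of a measurable set. -/
noncomputable def ind (μ : Measure X) {A : Set X} (hA : MeasurableSet A) : LInfty μ :=
  ⟨AEEqFun.mk _ (memLp_indicator_one (μ := μ) hA).1,
    (memLp_congr_ae (AEEqFun.coeFn_mk _ _)).2 (memLp_indicator_one hA)⟩

theorem coeFn_ind {A : Set X} (hA : MeasurableSet A) :
    (ind μ hA : X →ₘ[μ] ℂ) =ᵐ[μ] A.indicator fun _ => 1 :=
  AEEqFun.coeFn_mk _ _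

theorem ind_mul_ind {A A' : Set X} (hA : MeasurableSet A) (hA' : MeasurableSet A') :
    ind μ hA * ind μ hA' = ind μ (hA.inter hA') := by
  refine ext_ae ?_
  filter_upwards [coeFn_mul (ind μ hA) (ind μ hA'), coeFn_ind (μ := μ) hA, coeFn_ind (μ := μ) hA',
    coeFn_ind (μ := μ) (hA.inter hA')] with x h1 h2 h3 h4
  rw [h1, h2, h3, h4]
  by_cases hx : x ∈ A <;> by_cases hx' : x ∈ A' <;> simp [hx, hx']

theorem one_sub_ind {A : Set X} (hA : MeasurableSet A) : 1 - ind μ hA = ind μ hA.compl := by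
  refine ext_ae ?_
  filter_upwards [coeFn_sub 1 (ind μ hA), coeFn_one (μ := μ), coeFn_ind (μ := μ) hA,
    coeFn_ind (μ := μ) hA.compl] with x h1 h2 h3 h4
  rw [h1, h2, h3, h4]
  by_cases hx : x ∈ A <;> simp [hx]

theorem integral_ind {A : Set X} (hA : MeasurableSet A) :
    ∫ x, (ind μ hA : X →ₘ[μ] ℂ) x ∂μ = (μ.real A : ℂ) := by
  rw [integral_congr_ae (coeFn_ind hA), integral_indicator_const _ hA]
  simp

theorem integral_ind_mul {A : Set X} (hA : MeasurableSet A) (f : LInfty μ) :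
    ∫ x, ((ind μ hA * f : LInfty μ) : X →ₘ[μ] ℂ) x ∂μ = ∫ x in A, (f : X →ₘ[μ] ℂ) x ∂μ := by
  rw [← integral_indicator hA]
  refine integral_congr_ae ?_
  filter_upwards [coeFn_mul (ind μ hA) f, coeFn_ind (μ := μ) hA] with x h1 h2
  rw [h1, h2]
  by_cases hx : x ∈ A <;> simp [hx]

/-- A projection of `L^∞(X, μ)` is the indicator function of a measurable set. -/
theorem exists_eq_ind {p : LInfty μ} (hp : p * p = p) :
    ∃ (B : Set X) (hB : MeasurableSet B), p = ind μ hB := by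
  refine ⟨{x | (p : X →ₘ[μ] ℂ) x = 1},
    (AEEqFun.measurable _) (measurableSet_singleton 1), ext_ae ?_⟩
  have h := coeFn_mul p p
  rw [hp] at h
  filter_upwards [h, coeFn_ind (μ := μ) (A := {x | (p : X →ₘ[μ] ℂ) x = 1})
    ((AEEqFun.measurable _) (measurableSet_singleton 1))] with x h1 h2
  rw [h2]
  by_cases hx : (p : X →ₘ[μ] ℂ) x = 1
  · simp [hx]
  · have : (p : X →ₘ[μ] ℂ) x = 0 := by
      by_contra h0
      exact hx (mul_left_cancel₀ h0 (by rw [mul_one, ← h1]))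
    simp [this]

theorem ae_eq_of_ind_eq {A B : Set X} {hA : MeasurableSet A} {hB : MeasurableSet B}
    (h : ind μ hA = ind μ hB) : A =ᵐ[μ] B := by
  have h' := coeFn_ind (μ := μ) hA
  rw [h] at h'
  filter_upwards [h', coeFn_ind (μ := μ) hB] with x h1 h2
  rw [h1] at h2
  refine propext ?_
  change x ∈ A ↔ x ∈ B
  by_cases hx : x ∈ A <;> by_cases hx' : x ∈ B <;> simp_all

theorem ind_eq_of_ae_eq {A B : Set X} {hA : MeasurableSet A} {hB : MeasurableSet B}
    (h : A =ᵐ[μ] B) : ind μ hA = ind μ hB :=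
  ext_ae ((coeFn_ind hA).trans ((indicator_ae_eq_of_ae_eq_set h).trans (coeFn_ind hB).symm))

theorem comp_ind {φ : X → Y} (hφ : MeasurePreserving φ μ ν) {A : Set Y} (hA : MeasurableSet A) :
    comp φ hφ (ind ν hA) = ind μ (hφ.measurable hA) := by
  refine ext_ae ?_
  filter_upwards [coeFn_comp hφ (ind ν hA), coeFn_ind (μ := μ) (hφ.measurable hA),
    hφ.quasiMeasurePreserving.ae (coeFn_ind (μ := ν) hA)] with x h1 h2 h3
  rw [h1, h2, h3]
  rfl

theorem comp_mul {φ : X → Y} (hφ : MeasurePreserving φ μ ν) (f g : LInfty ν) :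
    comp φ hφ (f * g) = comp φ hφ f * comp φ hφ g := by
  refine ext_ae ?_
  filter_upwards [coeFn_comp hφ (f * g), coeFn_mul (comp φ hφ f) (comp φ hφ g), coeFn_comp hφ f,
    coeFn_comp hφ g, hφ.quasiMeasurePreserving.ae (coeFn_mul f g)] with x h1 h2 h3 h4 h5
  rw [h1, h2, h3, h4, h5]

theorem comp_add {φ : X → Y} (hφ : MeasurePreserving φ μ ν) (f g : LInfty ν) :
    comp φ hφ (f + g) = comp φ hφ f + comp φ hφ g := by
  refine ext_ae ?_
  filter_upwards [coeFn_comp hφ (f + g), coeFn_add (comp φ hφ f) (comp φ hφ g), coeFn_comp hφ f,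
    coeFn_comp hφ g, hφ.quasiMeasurePreserving.ae (coeFn_add f g)] with x h1 h2 h3 h4 h5
  rw [h1, h2, h3, h4, h5]

theorem comp_star {φ : X → Y} (hφ : MeasurePreserving φ μ ν) (f : LInfty ν) :
    comp φ hφ (star f) = star (comp φ hφ f) := by
  refine ext_ae ?_
  filter_upwards [coeFn_comp hφ (star f), coeFn_star (comp φ hφ f), coeFn_comp hφ f,
    hφ.quasiMeasurePreserving.ae (coeFn_star f)] with x h1 h2 h3 h4
  rw [h1, h2, h3, h4]

theorem comp_smul {φ : X → Y} (hφ : MeasurePreserving φ μ ν) (c : ℂ) (f : LInfty ν) :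
    comp φ hφ (c • f) = c • comp φ hφ f := by
  refine ext_ae ?_
  filter_upwards [coeFn_comp hφ (c • f), coeFn_smul c (comp φ hφ f), coeFn_comp hφ f,
    hφ.quasiMeasurePreserving.ae (coeFn_smul c f)] with x h1 h2 h3 h4
  rw [h1, h2, h3, h4]

theorem comp_comp_of_ae_eq {φ : X → Y} {ψ : Y → X} (hφ : MeasurePreserving φ μ ν)
    (hψ : MeasurePreserving ψ ν μ) (h : ∀ᵐ x ∂μ, ψ (φ x) = x) (f : LInfty μ) :
    comp φ hφ (comp ψ hψ f) = f := by
  refine ext_ae ?_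
  filter_upwards [coeFn_comp hφ (comp ψ hψ f), hφ.quasiMeasurePreserving.ae (coeFn_comp hψ f), h]
    with x h1 h2 h3
  rw [h1, h2, h3]

end LInfty

/-- The `*`-isomorphism `f ↦ f ∘ a⁻¹` induced by an isomorphism `a`. -/
noncomputable def IsoRep.starAlgEquiv (a : IsoRep μ ν) : LInfty μ ≃⋆ₐ[ℂ] LInfty ν where
  toFun := LInfty.comp a.invFun a.mp_invFun
  invFun := LInfty.comp a.toFun a.mp_toFun
  left_inv := LInfty.comp_comp_of_ae_eq a.mp_toFun a.mp_invFun a.left_inv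
  right_inv := LInfty.comp_comp_of_ae_eq a.mp_invFun a.mp_toFun a.right_inv
  map_mul' := LInfty.comp_mul a.mp_invFun
  map_add' := LInfty.comp_add a.mp_invFun
  map_star' := LInfty.comp_star a.mp_invFun
  map_smul' := LInfty.comp_smul a.mp_invFun

theorem IsoRep.isTracePreserving_starAlgEquiv (a : IsoRep μ ν) :
    IsTracePreserving a.starAlgEquiv :=
  fun f => LInfty.integral_comp a.mp_invFun f

theorem IsTracePreserving.symm {α : LInfty μ ≃⋆ₐ[ℂ] LInfty ν} (h : IsTracePreserving α) :
    IsTracePreserving α.symm := fun f => by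
  have := h (α.symm f)
  rw [StarAlgEquiv.apply_symm_apply] at this
  exact this.symm

/-- On indicator functions, a trace preserving `*`-isomorphism from the `L^∞`-algebra of a standard
probability space is composition with a point map. -/
theorem IsTracePreserving.exists_map_ind [StandardBorelSpace X] [IsProbabilityMeasure μ]
    [IsProbabilityMeasure ν] {α : LInfty μ ≃⋆ₐ[ℂ] LInfty ν} (h : IsTracePreserving α) :
    ∃ (ψ : Y → X) (hψ : MeasurePreserving ψ ν μ), ∀ (A : Set X) (hA : MeasurableSet A),
      α (LInfty.ind μ hA) = LInfty.ind ν (hψ.measurable hA) := by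
  classical
  have hex : ∀ A : Set X, ∃ B : Set Y, ∃ hB : MeasurableSet B,
      ∀ hA : MeasurableSet A, α (LInfty.ind μ hA) = LInfty.ind ν hB := by
    intro A
    by_cases hA : MeasurableSet A
    · obtain ⟨B, hB, e⟩ := LInfty.exists_eq_ind (p := α (LInfty.ind μ hA)) (by
        rw [← map_mul, LInfty.ind_mul_ind]
        congr 1
        exact LInfty.ind_eq_of_ae_eq (by rw [Set.inter_self]; exact ae_eq_refl _))
      exact ⟨B, hB, fun _ => e⟩
    · exact ⟨∅, .empty, fun h => absurd h hA⟩
  choose B hB hBα using hex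
  -- Complements, intersections and measures of sets are `1 - p`, products and traces of
  -- projections, all of which `α` respects.
  obtain ⟨ψ, hψ, hψB⟩ := exists_measurePreserving_preimage_ae_eq ν μ B (fun A _ => hB A)
    (fun A hA => by
      refine LInfty.ae_eq_of_ind_eq (hA := hB _) (hB := (hB _).compl) ?_
      rw [← hBα _ hA.compl, ← LInfty.one_sub_ind hA, ← LInfty.one_sub_ind (hB A), ← hBα _ hA,
        map_sub, map_one])
    (fun A A' hA hA' => by
      refine LInfty.ae_eq_of_ind_eq (hA := hB _) (hB := (hB _).inter (hB _)) ?_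
      rw [← hBα _ (hA.inter hA'), ← LInfty.ind_mul_ind hA hA', ← LInfty.ind_mul_ind (hB A) (hB A'),
        map_mul, hBα _ hA, hBα _ hA'])
    (fun A hA => by
      have := h (LInfty.ind μ hA)
      rw [hBα _ hA, LInfty.integral_ind, LInfty.integral_ind, Complex.ofReal_inj] at this
      exact (measureReal_eq_measureReal_iff).1 this)
  exact ⟨ψ, hψ, fun A hA => (hBα A hA).trans (LInfty.ind_eq_of_ae_eq (hψB A hA).symm)⟩

theorem ae_eq_id_of_preimage_ae_eq [MeasurableSpace.CountablySeparated X] {f : X → X}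
    (h : ∀ A, MeasurableSet A → f ⁻¹' A =ᵐ[μ] A) : ∀ᵐ x ∂μ, f x = x :=
  EventuallyEq.of_forall_separating_preimage MeasurableSet h

/-- Trace preserving `*`-isomorphisms between the `L^∞`-algebras of standard probability spaces are
induced by isomorphisms of probability spaces. -/
theorem IsTracePreserving.exists_isoRep [StandardBorelSpace X] [StandardBorelSpace Y]
    [IsProbabilityMeasure μ] [IsProbabilityMeasure ν] {α : LInfty μ ≃⋆ₐ[ℂ] LInfty ν}
    (h : IsTracePreserving α) :
    ∃ a : IsoRep μ ν, ∀ f, α f = LInfty.comp a.invFun a.mp_invFun f := by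
  obtain ⟨ψ, hψ, hψα⟩ := h.exists_map_ind
  obtain ⟨φ, hφ, hφα⟩ := h.symm.exists_map_ind
  refine ⟨⟨φ, ψ, hφ, hψ, ?_, ?_⟩, fun f => LInfty.ext_ae ?_⟩
  · refine ae_eq_id_of_preimage_ae_eq fun A hA => ?_
    refine LInfty.ae_eq_of_ind_eq (hA := hφ.measurable (hψ.measurable hA)) (hB := hA) ?_
    exact (hφα _ (hψ.measurable hA)).symm.trans (by rw [← hψα, StarAlgEquiv.symm_apply_apply])
  · refine ae_eq_id_of_preimage_ae_eq fun A hA => ?_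
    refine LInfty.ae_eq_of_ind_eq (hA := hψ.measurable (hφ.measurable hA)) (hB := hA) ?_
    exact (hψα _ (hφ.measurable hA)).symm.trans (by rw [← hφα, StarAlgEquiv.apply_symm_apply])
  -- Passing from indicators to all `f` needs no continuity of `α`: writing the indicator of `A` as
  -- the image of that of `φ ⁻¹' A`, multiplicativity and the trace identify all integrals over `A`.
  · refine Integrable.ae_eq_of_forall_setIntegral_eq _ _ (LInfty.integrable _)
      (LInfty.integrable _) fun A hA _ => ?_
    have e : LInfty.comp ψ hψ (LInfty.ind μ (hφ.measurable hA)) = LInfty.ind ν hA := by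
      rw [LInfty.comp_ind, ← hψα _ (hφ.measurable hA), ← hφα, StarAlgEquiv.apply_symm_apply]
    rw [← LInfty.integral_ind_mul hA, ← LInfty.integral_ind_mul hA]
    conv_rhs => rw [← e, ← LInfty.comp_mul, LInfty.integral_comp]
    rw [← h (LInfty.ind μ (hφ.measurable hA) * f), map_mul, ← hφα, StarAlgEquiv.apply_symm_apply]

end LInftyMaps

/-! ### Coordinatewise isomorphisms and the first half -/

section ProductIso

variable {I J X₀ Y₀ : Type*} [MeasurableSpace X₀] [MeasurableSpace Y₀]
  {μ₀ : Measure X₀} [IsProbabilityMeasure μ₀] {ν₀ : Measure Y₀} [IsProbabilityMeasure ν₀]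

theorem measurePreserving_pi_reindex (e : J ≃ I) (f : J → X₀ → Y₀)
    (hf : ∀ j, MeasurePreserving (f j) μ₀ ν₀) :
    MeasurePreserving (fun (x : I → X₀) j => f j (x (e j))) (prodMeasure I μ₀)
      (prodMeasure J ν₀) := by
  have hm : Measurable fun (x : I → X₀) j => f j (x (e j)) :=
    measurable_pi_lambda _ fun j => (hf j).measurable.comp (measurable_pi_apply (e j))
  refine ⟨hm, ?_⟩
  refine Measure.eq_infinitePi _ fun s t ht => ?_
  rw [Measure.map_apply hm (.pi s.countable_toSet fun _ _ => ht _)]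
  have h : (fun (x : I → X₀) j => f j (x (e j))) ⁻¹' (s : Set J).pi t =
      ((s.map e.toEmbedding : Finset I) : Set I).pi fun i => f (e.symm i) ⁻¹' t (e.symm i) := by
    ext x
    simp only [Set.mem_preimage, Set.mem_pi, Finset.coe_map, Set.forall_mem_image,
      Equiv.coe_toEmbedding, Equiv.symm_apply_apply]
  rw [h, Measure.infinitePi_pi _ fun i _ => (hf _).measurable (ht _), Finset.prod_map]
  refine Finset.prod_congr rfl fun j _ => ?_
  simp only [Equiv.coe_toEmbedding, Equiv.symm_apply_apply]
  exact (hf j).measure_preimage (ht j).nullMeasurableSet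

theorem ae_eval {P : X₀ → Prop} (h : ∀ᵐ t ∂μ₀, P t) (i : I) :
    ∀ᵐ x ∂prodMeasure I μ₀, P (x i) :=
  (measurePreserving_eval_infinitePi (fun _ : I => μ₀) i).quasiMeasurePreserving.ae h

/-- Evaluation pushes the product measure to `μ₀`, so measurable conditions descend; agreement is
tested on one separating set at a time. -/
theorem ae_eq_of_ae_eval_eq {Z : Type*} [MeasurableSpace Z]
    [MeasurableSpace.CountablySeparated Z] {f g : X₀ → Z} (hf : Measurable f) (hg : Measurable g)
    {i : I} (h : ∀ᵐ x ∂prodMeasure I μ₀, f (x i) = g (x i)) : f =ᵐ[μ₀] g := by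
  refine EventuallyEq.of_forall_separating_mem_iff MeasurableSet fun A hA => ?_
  have hm : MeasurableSet {t | f t ∈ A ↔ g t ∈ A} := (hf hA).iff (hg hA)
  rw [← (measurePreserving_eval_infinitePi (fun _ : I => μ₀) i).map_eq,
    ae_map_iff (measurePreserving_eval_infinitePi (fun _ : I => μ₀) i).aemeasurable hm]
  exact h.mono fun x hx => by simp only [Function.eval, hx]

/-- The isomorphism of product spaces given by a bijection of the index sets and an isomorphism of
the base spaces for each index. -/
def IsoRep.pi [Countable I] [Countable J] (η : I ≃ J) (b : I → IsoRep μ₀ ν₀) :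
    IsoRep (prodMeasure I μ₀) (prodMeasure J ν₀) where
  toFun x j := (b (η.symm j)).toFun (x (η.symm j))
  invFun y i := (b i).invFun (y (η i))
  mp_toFun := measurePreserving_pi_reindex η.symm _ fun _ => (b _).mp_toFun
  mp_invFun := measurePreserving_pi_reindex η _ fun _ => (b _).mp_invFun
  left_inv := by
    filter_upwards [ae_all_iff.2 fun i => ae_eval (I := I) (b i).left_inv i] with x hx
    funext i
    simp only [Equiv.symm_apply_apply, hx]
  right_inv := by
    filter_upwards [ae_all_iff.2 fun j => ae_eval (I := J) (b (η.symm j)).right_inv j] with y hy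
    funext j
    simp only [Equiv.apply_symm_apply, hy]

variable {Γ : Type*} [Group Γ] [MulAction Γ I]

/-- The bridge between algebras and points used in both halves. Testing on indicators recovers the
point maps; inverses appear because `Δ_*` is composition with `Δ⁻¹`. -/
theorem isImplementedBy_mk_iff [MeasurableSpace.CountablySeparated X₀]
    (a : IsoRep (prodMeasure I μ₀) (prodMeasure J ν₀)) (Γ₁ : Subgroup Γ) (η : I ≃ J)
    (α : MulAction.orbitRel.Quotient Γ₁ I → (LInfty μ₀ ≃⋆ₐ[ℂ] LInfty ν₀))
    (c : MulAction.orbitRel.Quotient Γ₁ I → IsoRep μ₀ ν₀)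
    (hc : ∀ o f, α o f = LInfty.comp (c o).invFun (c o).mp_invFun f) :
    IsImplementedBy (ProbIso.mk a) Γ₁ η α ↔ ∀ i, ∀ᵐ y ∂prodMeasure J ν₀,
      a.invFun y i = (c (Quotient.mk (MulAction.orbitRel Γ₁ I) i)).invFun (y (η i)) := by
  have hL : ∀ (i : I) (f : LInfty μ₀),
      ((ProbIso.mk a).pushforward (coordEmb μ₀ i f) : (J → Y₀) →ₘ[prodMeasure J ν₀] ℂ)
        =ᵐ[prodMeasure J ν₀] fun y => (f : X₀ →ₘ[μ₀] ℂ) (a.invFun y i) := by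
    intro i f
    change (LInfty.comp a.invFun a.mp_invFun (coordEmb μ₀ i f) :
      (J → Y₀) →ₘ[prodMeasure J ν₀] ℂ) =ᵐ[prodMeasure J ν₀] _
    filter_upwards [LInfty.coeFn_comp a.mp_invFun (coordEmb μ₀ i f),
      a.mp_invFun.quasiMeasurePreserving.ae (LInfty.coeFn_comp
        (measurePreserving_eval_infinitePi (fun _ : I => μ₀) i) f)] with y h1 h2
    rw [h1, coordEmb, h2, Function.eval]
  have hR : ∀ (i : I) (f : LInfty μ₀),
      (coordEmb ν₀ (η i) (α (Quotient.mk (MulAction.orbitRel Γ₁ I) i) f) :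
        (J → Y₀) →ₘ[prodMeasure J ν₀] ℂ) =ᵐ[prodMeasure J ν₀] fun y => (f : X₀ →ₘ[μ₀] ℂ)
          ((c (Quotient.mk (MulAction.orbitRel Γ₁ I) i)).invFun (y (η i))) := by
    intro i f
    rw [hc]
    filter_upwards [LInfty.coeFn_comp (measurePreserving_eval_infinitePi (fun _ : J => ν₀) (η i))
      (LInfty.comp _ (c (Quotient.mk (MulAction.orbitRel Γ₁ I) i)).mp_invFun f),
      ae_eval (LInfty.coeFn_comp (c (Quotient.mk (MulAction.orbitRel Γ₁ I) i)).mp_invFun f)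
        (η i)] with y h1 h2
    rw [coordEmb, h1, Function.eval, h2]
  constructor
  · intro h i
    refine EventuallyEq.of_forall_separating_mem_iff MeasurableSet fun A hA => ?_
    have h1 := hL i (LInfty.ind μ₀ hA)
    rw [h i] at h1
    have hmp : MeasurePreserving (fun y : J → Y₀ => a.invFun y i) (prodMeasure J ν₀) μ₀ :=
      (measurePreserving_eval_infinitePi (fun _ : I => μ₀) i).comp a.mp_invFun
    filter_upwards [h1, hR i (LInfty.ind μ₀ hA),
      hmp.quasiMeasurePreserving.ae (LInfty.coeFn_ind (μ := μ₀) hA),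
      ae_eval ((c (Quotient.mk (MulAction.orbitRel Γ₁ I) i)).mp_invFun.quasiMeasurePreserving.ae
        (LInfty.coeFn_ind (μ := μ₀) hA)) (η i)] with y e1 e2 e3 e4
    rw [e1, e3, e4] at e2
    by_cases h1 : a.invFun y i ∈ A <;>
      by_cases h2 : (c (Quotient.mk (MulAction.orbitRel Γ₁ I) i)).invFun (y (η i)) ∈ A <;>
      simp_all
  · intro h i f
    refine LInfty.ext_ae ?_
    filter_upwards [hL i f, hR i f, h i] with y e1 e2 e3
    rw [e1, e2, e3]

theorem ProbIso.mk_eq_of_invFun_ae_eq {X Y : Type*} [MeasurableSpace X] [MeasurableSpace Y]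
    {μ : Measure X} {ν : Measure Y} {a b : IsoRep μ ν} (h : a.invFun =ᵐ[ν] b.invFun) :
    ProbIso.mk a = ProbIso.mk b :=
  Quotient.sound (IsoRep.symm_congr (a := a.symm) (b := b.symm) h)

variable {Λ : Type*} [Group Λ] [MulAction Λ J]

/-- Moving `i` inside its `Γ₁`-orbit does not change the base map, and `η` intertwines the two
translations, so the inverse of `a` does too. -/
theorem conj_bernoulli_eq [Countable I] {Γ₁ : Subgroup Γ} {Λ₁ : Subgroup Λ} {δ : Γ₁ ≃* Λ₁}
    {η : I ≃ J} (hη : ∀ (g : Γ₁) (i : I), η ((g : Γ) • i) = (δ g : Λ) • η i)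
    (a : IsoRep (prodMeasure I μ₀) (prodMeasure J ν₀))
    (c : MulAction.orbitRel.Quotient Γ₁ I → IsoRep μ₀ ν₀)
    (h : ∀ i, ∀ᵐ y ∂prodMeasure J ν₀,
      a.invFun y i = (c (Quotient.mk (MulAction.orbitRel Γ₁ I) i)).invFun (y (η i))) (g : Γ₁) :
    (ProbIso.mk a).conj (bernoulli Γ I μ₀ g) = bernoulli Λ J ν₀ (δ g) := by
  refine Quotient.sound ?_
  change (fun y => a.toFun fun i => a.invFun y ((g : Γ)⁻¹ • i)) =ᵐ[prodMeasure J ν₀]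
    fun y j => y ((δ g : Λ)⁻¹ • j)
  have hmp : MeasurePreserving (fun (y : J → Y₀) j => y ((δ g : Λ)⁻¹ • j)) (prodMeasure J ν₀)
      (prodMeasure J ν₀) := measurePreserving_reindex ν₀ (MulAction.toPerm (δ g : Λ)⁻¹)
  have hall := ae_all_iff.2 h
  filter_upwards [hall, hmp.quasiMeasurePreserving.ae hall,
    hmp.quasiMeasurePreserving.ae a.right_inv] with y h1 h2 h3
  -- Writing the translate of `y` as an image under `a` reduces the claim to equality of the
  -- arguments of `a.toFun`.
  rw [← h3]
  congr 1
  funext i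
  rw [h1, h2]
  have e1 : (δ g : Λ)⁻¹ • η i = η ((g : Γ)⁻¹ • i) := by
    have := hη g⁻¹ i
    rw [map_inv, InvMemClass.coe_inv, InvMemClass.coe_inv] at this
    exact this.symm
  have e2 : (Quotient.mk (MulAction.orbitRel Γ₁ I) ((g : Γ)⁻¹ • i)) =
      Quotient.mk (MulAction.orbitRel Γ₁ I) i :=
    Quotient.sound (MulAction.orbitRel_apply.2 ⟨g⁻¹, rfl⟩)
  rw [e1, e2]

theorem isCommensuration_of_conj {Γ₁ : Subgroup Γ} {Λ₁ : Subgroup Λ} [Γ₁.FiniteIndex]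
    [Λ₁.FiniteIndex] (δ : Γ₁ ≃* Λ₁) (Δ : ProbIso (prodMeasure I μ₀) (prodMeasure J ν₀))
    (h : ∀ g : Γ₁, Δ.conj (bernoulli Γ I μ₀ g) = bernoulli Λ J ν₀ (δ g)) :
    IsCommensuration (bernoulli Γ I μ₀).range (bernoulli Λ J ν₀).range Δ := by
  constructor
  · rw [Subgroup.isFiniteRelIndex_iff_relIndex_ne_zero, ← Subgroup.index_comap]
    have hle : Γ₁ ≤ ((bernoulli Λ J ν₀).range.comap Δ.conj).comap (bernoulli Γ I μ₀) :=
      fun g hg => ⟨δ ⟨g, hg⟩, (h ⟨g, hg⟩).symm⟩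
    exact (Subgroup.finiteIndex_of_le hle).index_ne_zero
  · rw [Subgroup.isFiniteRelIndex_iff_relIndex_ne_zero, ← Subgroup.index_comap]
    have hle : Λ₁ ≤ ((bernoulli Γ I μ₀).range.map Δ.conj).comap (bernoulli Λ J ν₀) := by
      intro l hl
      refine ⟨bernoulli Γ I μ₀ (δ.symm ⟨l, hl⟩ : Γ₁), ⟨_, rfl⟩, ?_⟩
      rw [h, MulEquiv.apply_symm_apply]
    exact (Subgroup.finiteIndex_of_le hle).index_ne_zero

/-- A bijection of the index sets commensurating the actions, with isomorphisms of the base algebras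
constant on orbits, implements a unique isomorphism, which is a commensuration. -/
theorem existsUnique_isImplementedBy [Countable I] [Countable J] [StandardBorelSpace X₀]
    [StandardBorelSpace Y₀] {Γ₁ : Subgroup Γ} {Λ₁ : Subgroup Λ} {δ : Γ₁ ≃* Λ₁} {η : I ≃ J}
    (hη : IsBijCommensuration Γ₁ Λ₁ δ η)
    (α : MulAction.orbitRel.Quotient Γ₁ I → (LInfty μ₀ ≃⋆ₐ[ℂ] LInfty ν₀))
    (hα : ∀ o, IsTracePreserving (α o)) :
    (∃! Δ : ProbIso (prodMeasure I μ₀) (prodMeasure J ν₀), IsImplementedBy Δ Γ₁ η α) ∧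
      ∀ Δ : ProbIso (prodMeasure I μ₀) (prodMeasure J ν₀), IsImplementedBy Δ Γ₁ η α →
        IsCommensuration (bernoulli Γ I μ₀).range (bernoulli Λ J ν₀).range Δ := by
  choose c hc using fun o => (hα o).exists_isoRep
  refine ⟨⟨ProbIso.mk (IsoRep.pi η fun i => c (Quotient.mk _ i)),
    (isImplementedBy_mk_iff _ Γ₁ η α c hc).2 fun i => ae_of_all _ fun y => rfl, ?_⟩, ?_⟩
  · intro Δ hΔ
    induction Δ using Quotient.ind with
    | _ a =>
    have h := ae_all_iff.2 ((isImplementedBy_mk_iff a Γ₁ η α c hc).1 hΔ)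
    exact ProbIso.mk_eq_of_invFun_ae_eq (h.mono fun y hy => funext hy)
  · intro Δ hΔ
    induction Δ using Quotient.ind with
    | _ a =>
    have := hη.finiteIndex_left
    have := hη.finiteIndex_right
    exact isCommensuration_of_conj δ _ (conj_bernoulli_eq hη.map_smul a c
      ((isImplementedBy_mk_iff a Γ₁ η α c hc).1 hΔ))

end ProductIso

/-! ### Equivariant isomorphisms permute the coordinates -/

section Equivariant

variable {G I J X₀ Y₀ : Type*} [Group G] [MulAction G I] [MulAction G J]
  [MeasurableSpace X₀] [MeasurableSpace Y₀]
  {μ₀ : Measure X₀} [IsProbabilityMeasure μ₀] {ν₀ : Measure Y₀} [IsProbabilityMeasure ν₀]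

/-- Equivariance almost everywhere with respect to coordinate permutations. -/
def IsoRep.IsEquivariant (G : Type*) [Group G] [MulAction G I] [MulAction G J]
    (a : IsoRep (prodMeasure I μ₀) (prodMeasure J ν₀)) : Prop :=
  ∀ g : G, ∀ᵐ x ∂prodMeasure I μ₀, a.toFun (fun i => x (g • i)) = fun j => a.toFun x (g • j)

theorem IsoRep.IsEquivariant.symm {a : IsoRep (prodMeasure I μ₀) (prodMeasure J ν₀)}
    (ha : a.IsEquivariant G) : a.symm.IsEquivariant G := by
  intro g
  have hmp : MeasurePreserving (fun (x : I → X₀) i => x (g • i)) (prodMeasure I μ₀)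
      (prodMeasure I μ₀) := measurePreserving_reindex μ₀ (MulAction.toPerm g)
  change ∀ᵐ y ∂prodMeasure J ν₀, a.invFun (fun j => y (g • j)) = fun i => a.invFun y (g • i)
  filter_upwards [a.right_inv, a.mp_invFun.quasiMeasurePreserving.ae (ha g),
    a.mp_invFun.quasiMeasurePreserving.ae (hmp.quasiMeasurePreserving.ae a.left_inv)]
    with y h1 h2 h3
  rw [h2, h1] at h3
  exact h3

/-- An equivariant isomorphism sends each coordinate subalgebra into a coordinate subalgebra. -/
theorem exists_coordinate_of_isEquivariant [StandardBorelSpace X₀] [StandardBorelSpace Y₀]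
    (hI : StabInfiniteOrbits G I) (hμ₀ : ∀ x, μ₀ {x} ≠ 1)
    {a : IsoRep (prodMeasure I μ₀) (prodMeasure J ν₀)} (ha : a.IsEquivariant G) (i : I) :
    ∃ (j : J) (θ : X₀ → Y₀), Measurable θ ∧ ∀ᵐ x ∂prodMeasure I μ₀, a.toFun x j = θ (x i) := by
  -- Otherwise the stabilizer of `i` acts ergodically on the `J` side, and its invariant function
  -- `a.invFun y i` is constant, although its law is `μ₀`.
  have hj : ∃ j : J, (MulAction.stabilizer G j).relIndex (MulAction.stabilizer G i) ≠ 0 := by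
    by_contra! hcon
    have hmp : MeasurePreserving (fun y : J → Y₀ => a.invFun y i) (prodMeasure J ν₀) μ₀ :=
      (measurePreserving_eval_infinitePi (fun _ : I => μ₀) i).comp a.mp_invFun
    obtain ⟨c, hc⟩ := exists_ae_eq_const_of_invariant ν₀ (MulAction.stabilizer G i) hcon
      hmp.measurable fun g hg => by
        filter_upwards [ha.symm g] with y hy
        have := congrFun hy i
        rw [MulAction.mem_stabilizer_iff.1 hg] at this
        exact this
    refine hμ₀ c ?_
    rw [← prob_compl_eq_zero_iff (measurableSet_singleton c),
      ← hmp.measure_preimage (measurableSet_singleton c).compl.nullMeasurableSet]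
    exact ae_iff.1 hc
  obtain ⟨j, hj⟩ := hj
  refine ⟨j, exists_ae_eq_comp_eval_of_invariant μ₀
    (MulAction.stabilizer G j ⊓ MulAction.stabilizer G i) i
    (fun g hg => MulAction.mem_stabilizer_iff.1 hg.2) (fun k hk => ?_)
    ((measurable_pi_apply j).comp a.mp_toFun.measurable) fun g hg => ?_⟩
  · refine relIndex_eq_zero_of_relIndex_ne_zero (hI.relIndex_eq_zero hk) ?_
    rwa [Subgroup.inf_relIndex_right]
  · filter_upwards [ha g] with x hx
    have := congrFun hx j
    rw [MulAction.mem_stabilizer_iff.1 hg.1] at this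
    exact this

/-- Two indices whose coordinates determine each other under an isomorphism. -/
theorem comp_ae_of_coordinates {a : IsoRep (prodMeasure I μ₀) (prodMeasure J ν₀)} {i k : I} {j : J}
    {θ : X₀ → Y₀} {θ' : Y₀ → X₀} (h : ∀ᵐ x ∂prodMeasure I μ₀, a.toFun x j = θ (x i))
    (h' : ∀ᵐ y ∂prodMeasure J ν₀, a.invFun y k = θ' (y j)) :
    ∀ᵐ x ∂prodMeasure I μ₀, x k = θ' (θ (x i)) := by
  filter_upwards [h, a.mp_toFun.quasiMeasurePreserving.ae h', a.left_inv] with x h1 h2 h3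
  rw [h3, h1] at h2
  exact h2

/-- An equivariant isomorphism of product spaces is given by a bijection of the index sets and
isomorphisms of the base spaces. -/
theorem exists_equiv_of_isEquivariant [StandardBorelSpace X₀] [StandardBorelSpace Y₀]
    (hI : StabInfiniteOrbits G I) (hJ : StabInfiniteOrbits G J) (hμ₀ : ∀ x, μ₀ {x} ≠ 1)
    (hν₀ : ∀ y, ν₀ {y} ≠ 1) {a : IsoRep (prodMeasure I μ₀) (prodMeasure J ν₀)}
    (ha : a.IsEquivariant G) :
    ∃ (η : I ≃ J) (b : I → IsoRep μ₀ ν₀), (∀ (g : G) (i : I), η (g • i) = g • η i) ∧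
      (∀ i, ∀ᵐ y ∂prodMeasure J ν₀, a.invFun y i = (b i).invFun (y (η i))) ∧
      ∀ (g : G) (i : I), b (g • i) ≈ b i := by
  choose p θ hθ hpθ using exists_coordinate_of_isEquivariant hI hμ₀ ha
  choose q τ hτ hqτ using exists_coordinate_of_isEquivariant hJ hν₀ ha.symm
  change ∀ j, ∀ᵐ y ∂prodMeasure J ν₀, a.invFun y (q j) = τ j (y j) at hqτ
  -- Going across and back makes coordinate `q (p i)` a function of coordinate `i`.
  have hqp : ∀ i, q (p i) = i := fun i => eq_of_ae_eq_comp_eval μ₀ hμ₀ ((hτ _).comp (hθ _))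
    (comp_ae_of_coordinates (hpθ i) (hqτ (p i)))
  have hpq : ∀ j, p (q j) = j := fun j => eq_of_ae_eq_comp_eval ν₀ hν₀ ((hθ _).comp (hτ _))
    (comp_ae_of_coordinates (a := a.symm) (hqτ j) (hpθ (q j)))
  let η : I ≃ J := ⟨p, q, hqp, hpq⟩
  have hτ' : ∀ i, ∀ᵐ y ∂prodMeasure J ν₀, a.invFun y i = τ (p i) (y (p i)) := fun i => by
    have := hqτ (p i)
    rwa [hqp] at this
  have hinvθ : ∀ i, ∀ᵐ t ∂μ₀, τ (p i) (θ i t) = t := fun i =>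
    ae_eq_of_ae_eval_eq ((hτ _).comp (hθ i)) measurable_id
      ((comp_ae_of_coordinates (hpθ i) (hτ' i)).mono fun x hx => hx.symm)
  have hinvτ : ∀ i, ∀ᵐ t ∂ν₀, θ i (τ (p i) t) = t := fun i =>
    ae_eq_of_ae_eval_eq ((hθ i).comp (hτ _)) measurable_id
      ((comp_ae_of_coordinates (a := a.symm) (hτ' i) (hpθ i)).mono fun x hx => hx.symm)
  let b : I → IsoRep μ₀ ν₀ := fun i =>
    { toFun := θ i
      invFun := τ (p i)
      mp_toFun := measurePreserving_of_ae_eq_comp_eval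
        ((measurePreserving_eval_infinitePi (fun _ : J => ν₀) (p i)).comp a.mp_toFun) (hθ i) (hpθ i)
      mp_invFun := measurePreserving_of_ae_eq_comp_eval
        ((measurePreserving_eval_infinitePi (fun _ : I => μ₀) i).comp a.mp_invFun) (hτ _) (hτ' i)
      left_inv := hinvθ i
      right_inv := hinvτ i }
  have hg : ∀ (g : G) (i : I), ∀ᵐ x ∂prodMeasure I μ₀, a.toFun x (g • p i) = θ i (x (g • i)) := by
    intro g i
    have hmp : MeasurePreserving (fun (x : I → X₀) i => x (g • i)) (prodMeasure I μ₀)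
      (prodMeasure I μ₀) := measurePreserving_reindex μ₀ (MulAction.toPerm g)
    filter_upwards [ha g, hmp.quasiMeasurePreserving.ae (hpθ i)] with x h1 h2
    rw [← h2, h1]
  -- Both indices are matched with `g • i`, so coordinate `g • p i` is a function of coordinate `p
  -- (g • i)`.
  have hη : ∀ (g : G) (i : I), p (g • i) = g • p i := fun g i =>
    (eq_of_ae_eq_comp_eval ν₀ hν₀ ((hθ i).comp (hτ _))
      (comp_ae_of_coordinates (a := a.symm) (hτ' (g • i)) (hg g i))).symm
  refine ⟨η, b, hη, hτ', fun g i => ?_⟩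
  refine ae_eq_of_ae_eval_eq (hθ _) (hθ _) (i := g • i) (I := I) ?_
  filter_upwards [hpθ (g • i), hg g i] with x h1 h2
  exact h1.symm.trans ((congrArg _ (hη g i)).trans h2)

end Equivariant

/-! ### From commensurations to equivariant isomorphisms -/

section Commensuration

/-- The image of a stabilizer in `G` is the stabilizer in `Γ` cut by the range of `φ`, hence of
finite index in it. -/
theorem StabInfiniteOrbits.of_hom {G Γ I : Type*} [Group G] [Group Γ] [MulAction G I]
    [MulAction Γ I] (h : StabInfiniteOrbits Γ I) (φ : G →* Γ) (hφ : φ.range.FiniteIndex)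
    (hsmul : ∀ (g : G) (i : I), φ g • i = g • i) : StabInfiniteOrbits G I := by
  rw [stabInfiniteOrbits_iff]
  intro i k hk
  have hs : ∀ i : I, MulAction.stabilizer G i = (MulAction.stabilizer Γ i).comap φ := by
    intro i; ext g; simp [MulAction.mem_stabilizer_iff, hsmul]
  rw [hs, hs, Subgroup.relIndex_comap, Subgroup.map_comap_eq]
  refine relIndex_eq_zero_of_relIndex_ne_zero (h.relIndex_eq_zero hk) ?_
  rw [Subgroup.inf_relIndex_right]
  refine fun h0 => hφ.index_ne_zero ?_
  rw [← Subgroup.relIndex_top_right]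
  exact Subgroup.relIndex_eq_zero_of_le_right le_top h0

/-- A trivially acting `g` makes coordinates `g⁻¹ • i` and `i` equal almost everywhere, so these
indices coincide. -/
theorem bernoulli_injective {Γ I X₀ : Type*} [Group Γ] [MulAction Γ I] [FaithfulSMul Γ I]
    [MeasurableSpace X₀] [StandardBorelSpace X₀] (μ₀ : Measure X₀) [IsProbabilityMeasure μ₀]
    (hμ₀ : ∀ x, μ₀ {x} ≠ 1) : Function.Injective (bernoulli Γ I μ₀) := by
  rw [injective_iff_map_eq_one]
  intro g hg
  have h : ∀ᵐ x ∂prodMeasure I μ₀, (fun i => x (g⁻¹ • i)) = x := Quotient.exact hg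
  rw [← inv_eq_one]
  refine FaithfulSMul.eq_of_smul_eq_smul (α := I) fun i => ?_
  rw [one_smul]
  exact eq_of_ae_eq_comp_eval μ₀ hμ₀ measurable_id (h.mono fun x hx => congrFun hx i)

theorem ProbIso.conj_injective {X Y : Type*} [MeasurableSpace X] [MeasurableSpace Y]
    {μ : Measure X} {ν : Measure Y} (Δ : ProbIso μ ν) : Function.Injective Δ.conj := by
  have h : Function.LeftInverse Δ.symm.conj Δ.conj := by
    intro φ
    induction Δ using Quotient.ind with
    | _ a =>
    induction φ using Quotient.ind with
    | _ f =>
    refine Quotient.sound ?_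
    change a.invFun ∘ (a.toFun ∘ f.toFun ∘ a.invFun) ∘ a.toFun =ᵐ[μ] f.toFun
    filter_upwards [a.left_inv, f.mp_toFun.quasiMeasurePreserving.ae a.left_inv] with x h1 h2
    simp [h1, h2]
  exact h.injective

variable {Γ Λ I J X₀ Y₀ : Type*} [Group Γ] [Group Λ] [MulAction Γ I] [MulAction Λ J]
  [MeasurableSpace X₀] [MeasurableSpace Y₀]
  {μ₀ : Measure X₀} [IsProbabilityMeasure μ₀] {ν₀ : Measure Y₀} [IsProbabilityMeasure ν₀]

/-- A commensuration restricts to an isomorphism between subgroups of finite index. -/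
theorem IsCommensuration.exists_mulEquiv
    (hbΓ : Function.Injective (bernoulli Γ I μ₀)) (hbΛ : Function.Injective (bernoulli Λ J ν₀))
    {Δ : ProbIso (prodMeasure I μ₀) (prodMeasure J ν₀)}
    (hΔ : IsCommensuration (bernoulli Γ I μ₀).range (bernoulli Λ J ν₀).range Δ) :
    ∃ (Γ₁ : Subgroup Γ) (Λ₁ : Subgroup Λ) (δ : Γ₁ ≃* Λ₁), Γ₁.FiniteIndex ∧ Λ₁.FiniteIndex ∧
      ∀ g : Γ₁, Δ.conj (bernoulli Γ I μ₀ g) = bernoulli Λ J ν₀ (δ g) := by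
  obtain ⟨h1, h2⟩ := hΔ
  rw [Subgroup.isFiniteRelIndex_iff_relIndex_ne_zero, ← Subgroup.index_comap] at h1 h2
  set Γ₁ := ((bernoulli Λ J ν₀).range.comap Δ.conj).comap (bernoulli Γ I μ₀)
  set Λ₁ := ((bernoulli Γ I μ₀).range.map Δ.conj).comap (bernoulli Λ J ν₀)
  have hex : ∀ g : Γ₁, ∃ l : Λ₁, bernoulli Λ J ν₀ l = Δ.conj (bernoulli Γ I μ₀ g) := by
    rintro ⟨g, l, hl⟩
    exact ⟨⟨l, ⟨bernoulli Γ I μ₀ g, ⟨g, rfl⟩, hl.symm⟩⟩, hl⟩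
  choose d hd using hex
  let δ : Γ₁ →* Λ₁ := MonoidHom.mk' d fun g h => Subtype.ext <| hbΛ <| by
    rw [Subgroup.coe_mul, map_mul, hd, hd, hd, Subgroup.coe_mul, map_mul, map_mul]
  have hδ : Function.Bijective δ := by
    constructor
    · intro g h hgh
      have : d g = d h := hgh
      exact Subtype.ext (hbΓ (Δ.conj_injective (by rw [← hd, ← hd, this])))
    · rintro ⟨l, _, ⟨g, rfl⟩, hg⟩
      exact ⟨⟨g, l, hg.symm⟩, Subtype.ext (hbΛ ((hd _).trans hg))⟩
  exact ⟨Γ₁, Λ₁, MulEquiv.ofBijective δ hδ, ⟨h1⟩, ⟨h2⟩, fun g => (hd g).symm⟩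

theorem ae_toFun_smul_of_conj (a : IsoRep (prodMeasure I μ₀) (prodMeasure J ν₀)) (g : Γ) (l : Λ)
    (h : (ProbIso.mk a).conj (bernoulli Γ I μ₀ g) = bernoulli Λ J ν₀ l) :
    ∀ᵐ x ∂prodMeasure I μ₀, a.toFun (fun i => x (g⁻¹ • i)) = fun j => a.toFun x (l⁻¹ • j) := by
  have h' : (fun y => a.toFun fun i => a.invFun y (g⁻¹ • i)) =ᵐ[prodMeasure J ν₀]
    fun y j => y (l⁻¹ • j) := Quotient.exact h
  filter_upwards [a.mp_toFun.quasiMeasurePreserving.ae h', a.left_inv] with x h1 h2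
  rw [h2] at h1
  exact h1

/-- Every commensuration is implemented by a commensuration of the actions on the index sets and
isomorphisms of the base algebras. -/
theorem IsCommensuration.exists_isImplementedBy [FaithfulSMul Γ I] [FaithfulSMul Λ J]
    [StandardBorelSpace X₀] [StandardBorelSpace Y₀]
    (hΓ : StabInfiniteOrbits Γ I) (hΛ : StabInfiniteOrbits Λ J)
    (hμ₀ : ∀ x, μ₀ {x} ≠ 1) (hν₀ : ∀ y, ν₀ {y} ≠ 1)
    {Δ : ProbIso (prodMeasure I μ₀) (prodMeasure J ν₀)}
    (hΔ : IsCommensuration (bernoulli Γ I μ₀).range (bernoulli Λ J ν₀).range Δ) :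
    ∃ (Γ₁ : Subgroup Γ) (Λ₁ : Subgroup Λ) (δ : Γ₁ ≃* Λ₁) (η : I ≃ J)
      (α : MulAction.orbitRel.Quotient Γ₁ I → (LInfty μ₀ ≃⋆ₐ[ℂ] LInfty ν₀)),
      IsBijCommensuration Γ₁ Λ₁ δ η ∧ (∀ o, IsTracePreserving (α o)) ∧
        IsImplementedBy Δ Γ₁ η α := by
  obtain ⟨Γ₁, Λ₁, δ, hΓ₁, hΛ₁, hδ⟩ :=
    hΔ.exists_mulEquiv (bernoulli_injective μ₀ hμ₀) (bernoulli_injective ν₀ hν₀)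
  induction Δ using Quotient.ind with
  | _ a =>
  let φ : Γ₁ →* Λ := Λ₁.subtype.comp δ.toMonoidHom
  let _ : MulAction Γ₁ J := MulAction.compHom J φ
  have hI : StabInfiniteOrbits Γ₁ I :=
    hΓ.of_hom Γ₁.subtype (by rwa [Subgroup.range_subtype]) fun _ _ => rfl
  have hφ : φ.range = Λ₁ := by
    rw [MonoidHom.range_comp, MonoidHom.range_eq_top.2 δ.surjective, ← MonoidHom.range_eq_map,
      Subgroup.range_subtype]
  have hJ : StabInfiniteOrbits Γ₁ J := hΛ.of_hom φ (by rwa [hφ]) fun _ _ => rfl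
  have ha : a.IsEquivariant Γ₁ := by
    intro g
    -- `IsEquivariant` reads coordinates at `g • i`, the Bernoulli action at `g⁻¹ • i`.
    have := ae_toFun_smul_of_conj a _ _ (hδ g⁻¹)
    rw [map_inv, InvMemClass.coe_inv, InvMemClass.coe_inv, inv_inv, inv_inv] at this
    exact this
  obtain ⟨η, b, hη, hb, hbg⟩ := exists_equiv_of_isEquivariant hI hJ hμ₀ hν₀ ha
  -- Any representative of the orbit serves, since `b` is constant on orbits modulo null sets.
  refine ⟨Γ₁, Λ₁, δ, η, fun o => (b o.out).starAlgEquiv, ⟨hΓ₁, hΛ₁, fun g i => hη g i⟩,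
    fun o => (b o.out).isTracePreserving_starAlgEquiv, ?_⟩
  refine (isImplementedBy_mk_iff a Γ₁ η _ (fun o => b o.out) fun _ _ => rfl).2 fun i => ?_
  obtain ⟨g, hg⟩ : ∃ g : Γ₁, g • i = (Quotient.mk (MulAction.orbitRel Γ₁ I) i).out :=
    MulAction.orbitRel_apply.1 (Quotient.mk_out (s := MulAction.orbitRel Γ₁ I) i)
  have h := hbg g i
  rw [hg] at h
  filter_upwards [hb i, ae_eval (IsoRep.symm_congr h) (η i)] with y h1 h2
  rw [h1]
  exact h2.symm

end Commensuration

end GenBernoulli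

theorem proposition5p9
    {Γ Λ I J X₀ Y₀ : Type*} [Group Γ] [Countable Γ] [Group Λ] [Countable Λ]
    [Countable I] [Countable J]
    [MulAction Γ I] [FaithfulSMul Γ I] [MulAction Λ J] [FaithfulSMul Λ J]
    (hΓ : GenBernoulli.StabInfiniteOrbits Γ I) (hΛ : GenBernoulli.StabInfiniteOrbits Λ J)
    [MeasurableSpace X₀] [StandardBorelSpace X₀] [MeasurableSpace Y₀] [StandardBorelSpace Y₀]
    (μ₀ : Measure X₀) [IsProbabilityMeasure μ₀] (ν₀ : Measure Y₀) [IsProbabilityMeasure ν₀]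
    (hμ₀ : ∀ x : X₀, μ₀ {x} ≠ 1) (hν₀ : ∀ y : Y₀, ν₀ {y} ≠ 1) :
    -- the given data determine an isomorphism, and it is a commensuration
    (∀ (Γ₁ : Subgroup Γ) (Λ₁ : Subgroup Λ) (δ : Γ₁ ≃* Λ₁) (η : I ≃ J),
      GenBernoulli.IsBijCommensuration Γ₁ Λ₁ δ η →
      ∀ α : MulAction.orbitRel.Quotient Γ₁ I →
          (GenBernoulli.LInfty μ₀ ≃⋆ₐ[ℂ] GenBernoulli.LInfty ν₀),
        (∀ o, GenBernoulli.IsTracePreserving (α o)) →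
        (∃! Δ : GenBernoulli.ProbIso (GenBernoulli.prodMeasure I μ₀)
            (GenBernoulli.prodMeasure J ν₀),
          GenBernoulli.IsImplementedBy Δ Γ₁ η α) ∧
        ∀ Δ : GenBernoulli.ProbIso (GenBernoulli.prodMeasure I μ₀)
            (GenBernoulli.prodMeasure J ν₀),
          GenBernoulli.IsImplementedBy Δ Γ₁ η α →
          GenBernoulli.IsCommensuration (GenBernoulli.bernoulli Γ I μ₀).range
            (GenBernoulli.bernoulli Λ J ν₀).range Δ) ∧
    -- every commensuration arises in this way
    (∀ Δ : GenBernoulli.ProbIso (GenBernoulli.prodMeasure I μ₀)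
        (GenBernoulli.prodMeasure J ν₀),
      GenBernoulli.IsCommensuration (GenBernoulli.bernoulli Γ I μ₀).range
        (GenBernoulli.bernoulli Λ J ν₀).range Δ →
      ∃ (Γ₁ : Subgroup Γ) (Λ₁ : Subgroup Λ) (δ : Γ₁ ≃* Λ₁) (η : I ≃ J)
        (α : MulAction.orbitRel.Quotient Γ₁ I →
          (GenBernoulli.LInfty μ₀ ≃⋆ₐ[ℂ] GenBernoulli.LInfty ν₀)),
        GenBernoulli.IsBijCommensuration Γ₁ Λ₁ δ η ∧
        (∀ o, GenBernoulli.IsTracePreserving (α o)) ∧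
        GenBernoulli.IsImplementedBy Δ Γ₁ η α) :=
  ⟨fun _ _ _ _ hη α hα => GenBernoulli.existsUnique_isImplementedBy hη α hα,
    fun _ hΔ => hΔ.exists_isImplementedBy hΓ hΛ hμ₀ hν₀⟩
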